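/- **Theorem 3 (Refined Adams inequality on measure spaces).** Let $(M,\mu)$ and $(N,\nu)$ be $\sigma$-finite measure spaces, let $k:N\times M\to[-\infty,\infty]$ be $\nu\times\mu$-measurable, and let $$Tf(x)=\int_M k(x,y)f(y)\,d\mu(y),\qquad x\in N .$$ For a function $g$ on a measure space $(X,\lambda)$ let $g^*(t)=\inf\{s\ge 0:\lambda(\{|g|>s\})\le t\}$, $t>0$, be its nonincreasing rearrangement, and put $$k_1^*(t)=\sup_{x\in N}[k(x,\cdot)]^*(t),\qquad k_2^*(t)=\sup_{y\in M}[k(\cdot,y)]^*(t).$$ Let $\beta>1$, $\beta'=\frac{\beta}{\beta-1}$, $0<\sigma\le 1$, $\gamma>1$, $A>0$, $B\ge 0$, $H\ge 0$, and suppose that $$k_1^*(t)\le A^{1/\beta}t^{-1/\beta}\bigl(1+H(1+|\log t|)^{-\gamma}\bigr),\quad 0<t\le 1,\qquad k_2^*(t)\le B\,t^{-1/(\sigma\beta)},\quad t>0,$$ $$J:=\frac1A\int_1^\infty \bigl(k_1^*(t)\bigr)^\beta\,dt<\infty .$$ Then for every real-valued $f\in L^{\beta'}(M)$ the integral defining $Tf(x)$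 converges absolutely (so $Tf(x)$ is finite) for $\nu$-almost every $x\in N$, and there is a constant $C>0$ depending only on $\beta,\sigma,\gamma,A,B,H$ such that: 1. if $\nu(N)<\infty$, then for every $f\in L^{\beta'}(M)$ with $\|f\|_{\beta'}\le 1$ $$\int_N\exp\Bigl[\frac{\sigma}{A}|Tf(x)|^\beta\Bigr]d\nu(x)\le C e^{\sigma J}\bigl(1+J+\nu(N)\bigr);$$ 2. without the assumption $\nu(N)<\infty$, for every $f\in L^{\beta'}(M)$ with $\|f\|_{\beta'}\le 1$ $$\int_N\exp_{\lceil\beta'-2\rceil}\Bigl[\frac{\sigma}{A}|Tf(x)|^\beta\Bigr]d\nu(x)\le C e^{\sigma J}\bigl(1+J+\|Tf\|_{\beta'}^{\beta'}\bigr),$$ where $\exp_m(t)=e^t-\sum_{j=0}^m \frac{t^j}{j!}$ and $\lceil x\rceil$ is the smallest integer $\ge x$ (the right-hand side is $+\infty$ if $Tf\notin L^{\beta'}(N)$). -/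

import Mathlib

open MeasureTheory Set
open scoped ENNReal

universe u v

noncomputable section

/-- The nonincreasing rearrangement `g^*(t) = inf {s ≥ 0 : μ {|g| > s} ≤ t}`, `t > 0`, of an
extended real valued function `g` on a measure space. -/
def rearrangement {X : Type*} [MeasurableSpace X] (μ : Measure X) (g : X → EReal) (t : ℝ) : ℝ≥0∞ :=
  sInf {s : ℝ≥0∞ | μ {x | s < (g x).abs} ≤ ENNReal.ofReal t}

/-- `k₁^*(t) = sup_{x ∈ N} [k(x, ·)]^*(t)`. -/
def kernelRearr₁ {M N : Type*} [MeasurableSpace M] (μ : Measure M) (k : N → M → EReal) (t : ℝ) :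
    ℝ≥0∞ :=
  ⨆ x : N, rearrangement μ (fun y => k x y) t

/-- `k₂^*(t) = sup_{y ∈ M} [k(·, y)]^*(t)`. -/
def kernelRearr₂ {M N : Type*} [MeasurableSpace N] (ν : Measure N) (k : N → M → EReal) (t : ℝ) :
    ℝ≥0∞ :=
  ⨆ y : M, rearrangement ν (fun x => k x y) t

/-- `J = (1/A) ∫_1^∞ (k₁^*(t))^β dt`, as an element of `[0, ∞]`. -/
def tailIntegral {M N : Type*} [MeasurableSpace M] (μ : Measure M) (k : N → M → EReal)
    (A β : ℝ) : ℝ≥0∞ :=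
  (ENNReal.ofReal A)⁻¹ * ∫⁻ t in Ioi (1 : ℝ), kernelRearr₁ μ k t ^ β

/-- The integrand `y ↦ k(x, y) f(y)`. When `k₁^*` is finite on `(0, ∞)`, each `k(x, ·)` is finite
`μ`-almost everywhere, so that replacing the values `±∞` of `k` by `0` does not matter. -/
def kernelIntegrand {M N : Type*} (k : N → M → EReal) (f : M → ℝ) (x : N) (y : M) : ℝ :=
  (k x y).toReal * f y

/-- The integral operator `Tf(x) = ∫_M k(x, y) f(y) dμ(y)`. -/
def integralOp {M N : Type*} [MeasurableSpace M] (μ : Measure M) (k : N → M → EReal)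
    (f : M → ℝ) (x : N) : ℝ :=
  ∫ y, kernelIntegrand k f x y ∂μ

/-- The regularized exponential `exp_m(t) = e^t - ∑_{j=0}^m t^j / j!`. -/
def regExp (m : ℕ) (t : ℝ) : ℝ :=
  Real.exp t - ∑ j ∈ Finset.range (m + 1), t ^ j / (j.factorial : ℝ)

end

/-! After multiplying the kernel by `A ^ (-(1 / β))` and passing to absolute values, one bounds F(x)
= ∫ g(x, y) f(y) dμ(y) with g, f ≥ 0, A = 1 and ‖f‖_p ≤ 1, p = β'. Work on the scale of masses
e^{-n}. Let w_n select the largest values of f up to mass e^{-n}, let Φ_n = ∫ w_n f^p, and cut g at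
height (1 + H) e^{n/β}, which g(x, ·) exceeds only on a set of mass at most e^{-n}.

The only part of F not controlled pointwise is the singular one, where both f and g are large at
scale n. Splitting g = g^{1-θ} g^θ in Hölder's inequality and using both rearrangement bounds, its
p-th power has ν-integral at most D e^{-σn} Φ_n (`exists_lintegral_singularPart_rpow_le`). By
Chebyshev it exceeds Φ_n^{1/p} only on a set E_n with ν(E_n) ≤ D e^{-σn}. Off E_n, Hölder's
inequality on the remaining pieces gives, for every m ≤ n, a bound b(n, m) independent of x
(`lintegral_mul_le_pointwise`). It uses that the β-energy of the rearrangement over (e^{-n}, e^{-m}]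
is n - m + O(1), because (1 + |log t|)^{-γ} is integrable against dt/t for γ > 1.

With h_n = min over m ≤ n of b(n, m), integration over the layers between the sets E_n reduces
everything to bounding Σ exp(σ(h_n^β - n)) by C e^{σJ}, a discrete form of Adams' lemma
(`exists_tsum_exp_rpow_sub_le`). If h_m^β and h_n^β are both within l of their maximal growth, near
equality in Hölder at m forces Φ_m to be small, and then h^β grows at a rate less than 1 beyond m.
Hence only O(1 + l) indices have defect at most l, and the sum converges.

The outcome is a bound C e^{σJ}(1 + ν(S)) for the integral over any set S. The first claim takes S =
N. The second takes S = {|Tf| ≥ 1}, of measure at most ‖Tf‖_p^p; off S the regularized exponential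
is at most a multiple of |Tf|^p. -/

/-! ### Rearrangements and comparison of integrals by layers. -/

/-- The decreasing rearrangement of a `[0, ∞]`-valued function, with its argument in `[0, ∞]`. -/
noncomputable def upperLevel {X : Type*} [MeasurableSpace X] (μ : Measure X) (g : X → ℝ≥0∞)
    (T : ℝ≥0∞) : ℝ≥0∞ :=
  sInf {s : ℝ≥0∞ | μ {x | s < g x} ≤ T}

theorem measure_lt_of_upperLevel_lt {X : Type*} [MeasurableSpace X] {μ : Measure X}
    {g : X → ℝ≥0∞} {T s : ℝ≥0∞} (h : upperLevel μ g T < s) : μ {x | s < g x} ≤ T := by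
  obtain ⟨s', hs', hlt⟩ := sInf_lt_iff.1 h
  exact (measure_mono fun x hx => hlt.trans hx).trans hs'

/-- The infimum is attained: the superlevel set at the infimum is the increasing union of those at
levels decreasing to it, so no finiteness of measure is needed. -/
theorem measure_upperLevel_lt_le {X : Type*} [MeasurableSpace X] (μ : Measure X)
    (g : X → ℝ≥0∞) (T : ℝ≥0∞) : μ {x | upperLevel μ g T < g x} ≤ T := by
  rcases eq_or_ne (upperLevel μ g T) ⊤ with h | h
  · simp [h]
  · obtain ⟨u, hu, hu', hlim⟩ := exists_seq_strictAnti_tendsto' (lt_top_iff_ne_top.2 h)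
    have hU : {x | upperLevel μ g T < g x} = ⋃ n, {x | u n < g x} := by
      ext x
      simp only [mem_ofPred_eq, mem_iUnion]
      constructor
      · intro hx
        exact ((tendsto_order.1 hlim).2 _ hx).exists
      · rintro ⟨n, hn⟩
        exact (hu' n).1.trans hn
    rw [hU, Monotone.measure_iUnion]
    · exact iSup_le fun n => measure_lt_of_upperLevel_lt (hu' n).1
    · intro m n hmn x hx
      exact (hu.antitone hmn).trans_lt hx

theorem upperLevel_le_of_measure_le {X : Type*} [MeasurableSpace X] {μ : Measure X}
    {g : X → ℝ≥0∞} {T s : ℝ≥0∞} (h : μ {x | s < g x} ≤ T) : upperLevel μ g T ≤ s :=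
  sInf_le h

theorem upperLevel_antitone {X : Type*} [MeasurableSpace X] (μ : Measure X)
    (g : X → ℝ≥0∞) : Antitone (upperLevel μ g) := by
  intro S T hST
  exact sInf_le_sInf fun s hs => le_trans hs hST

theorem measure_le_of_lt_upperLevel {X : Type*} [MeasurableSpace X] {μ : Measure X}
    {g : X → ℝ≥0∞} {T s : ℝ≥0∞} (h : s < upperLevel μ g T) : T < μ {x | s < g x} := by
  by_contra! hc
  exact absurd (upperLevel_le_of_measure_le hc) (not_le.2 h)

theorem volume_pos_ofReal_lt (a : ℝ≥0∞) : volume {t : ℝ | 0 < t ∧ ENNReal.ofReal t < a} = a := by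
  rcases eq_or_ne a ⊤ with rfl | h
  · have : {t : ℝ | 0 < t ∧ ENNReal.ofReal t < ⊤} = Ioi 0 := by ext t; simp
    rw [this, Real.volume_Ioi]
  · have : {t : ℝ | 0 < t ∧ ENNReal.ofReal t < a} = Ioo 0 a.toReal := by
      ext t
      simp only [mem_ofPred_eq, mem_Ioo]
      refine and_congr_right fun ht => ?_
      rw [ENNReal.ofReal_lt_iff_lt_toReal ht.le h]
    rw [this, Real.volume_Ioo, sub_zero, ENNReal.ofReal_toReal h]

theorem measurableSet_pos_ofReal_lt (a : ℝ≥0∞) :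
    MeasurableSet {t : ℝ | 0 < t ∧ ENNReal.ofReal t < a} :=
  (measurableSet_lt measurable_const measurable_id).inter
    (measurableSet_lt ENNReal.measurable_ofReal measurable_const)

theorem lintegral_eq_lintegral_measure_ofReal_lt {X : Type*} [MeasurableSpace X] (μ : Measure X)
    [SFinite μ] {g : X → ℝ≥0∞} (hg : Measurable g) :
    ∫⁻ x, g x ∂μ = ∫⁻ u in Ioi (0 : ℝ), μ {x | ENNReal.ofReal u < g x} := by
  have h1 : ∀ x, g x = ∫⁻ u in Ioi (0 : ℝ),
      {p : X × ℝ | ENNReal.ofReal p.2 < g p.1}.indicator (fun _ => (1 : ℝ≥0∞)) (x, u) := by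
    intro x
    have : ∀ u : ℝ, {p : X × ℝ | ENNReal.ofReal p.2 < g p.1}.indicator
        (fun _ => (1 : ℝ≥0∞)) (x, u) = {u : ℝ | ENNReal.ofReal u < g x}.indicator 1 u := by
      intro u; simp [indicator]
    simp_rw [this]
    rw [lintegral_indicator_one (measurableSet_lt ENNReal.measurable_ofReal measurable_const),
      Measure.restrict_apply (measurableSet_lt ENNReal.measurable_ofReal measurable_const)]
    conv_lhs => rw [← volume_pos_ofReal_lt (g x)]
    congr 1
    ext u
    simp [and_comm]
  have hm : MeasurableSet {p : X × ℝ | ENNReal.ofReal p.2 < g p.1} :=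
    measurableSet_lt (ENNReal.measurable_ofReal.comp measurable_snd) (hg.comp measurable_fst)
  rw [lintegral_congr h1, lintegral_lintegral_swap
    (f := fun x u => {p : X × ℝ | ENNReal.ofReal p.2 < g p.1}.indicator
      (fun _ => (1 : ℝ≥0∞)) (x, u)) ((measurable_const.indicator hm).aemeasurable)]
  refine lintegral_congr fun u => ?_
  have : ∀ x : X, {p : X × ℝ | ENNReal.ofReal p.2 < g p.1}.indicator
      (fun _ => (1 : ℝ≥0∞)) (x, u) = {x | ENNReal.ofReal u < g x}.indicator 1 x := by
    intro x; simp [indicator]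
  simp_rw [this]
  rw [lintegral_indicator_one (measurableSet_lt measurable_const hg)]

/-- If `κ` dominates the rearrangement of `g`, then integrals of increasing functions of `g` are
dominated by those of `κ`, also for a smaller measure of mass at most `T`. -/
theorem lintegral_comp_le_of_rearr_le {X : Type*} [MeasurableSpace X] {μ μ' : Measure X}
    [SFinite μ'] (hle : μ' ≤ μ) {g : X → ℝ≥0∞} (hg : Measurable g) {κ : ℝ → ℝ≥0∞}
    (hκ : Measurable κ) (h : ∀ t : ℝ, 0 < t → μ {x | κ t < g x} ≤ ENNReal.ofReal t)
    {T : ℝ≥0∞} (hT : μ' univ ≤ T) {G : ℝ≥0∞ → ℝ≥0∞} (hG : Monotone G) :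
    ∫⁻ x, G (g x) ∂μ' ≤ ∫⁻ t in {t : ℝ | 0 < t ∧ ENNReal.ofReal t < T}, G (κ t) := by
  have hGm : Measurable G := hG.measurable
  rw [lintegral_eq_lintegral_measure_ofReal_lt μ' (g := fun x => G (g x)) (hGm.comp hg),
    lintegral_eq_lintegral_measure_ofReal_lt _ (g := fun t => G (κ t)) (hGm.comp hκ)]
  refine lintegral_mono fun u => ?_
  beta_reduce
  have hmeas : MeasurableSet {t | ENNReal.ofReal u < G (κ t)} :=
    measurableSet_lt measurable_const (hGm.comp hκ)
  rw [Measure.restrict_apply hmeas]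
  set t₀ := μ' {x | ENNReal.ofReal u < G (g x)} with ht₀
  conv_lhs => rw [← volume_pos_ofReal_lt t₀]
  -- For 0 < t < t₀ necessarily u < G (κ t): otherwise {u < G ∘ g} would lie in {κ t < g}, which has
  -- measure at most t.
  refine measure_mono fun t ht => ⟨?_, ht.1, ht.2.trans_le ((measure_mono (subset_univ _)).trans hT)⟩
  simp only [mem_ofPred_eq]
  by_contra! hc
  refine absurd ht.2 (not_lt.2 ?_)
  refine le_trans (hle _) (le_trans (measure_mono fun x hx => ?_) (h t ht.1))
  simp only [mem_ofPred_eq] at hx ⊢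
  by_contra! hc'
  exact absurd (hx.trans_le ((hG hc').trans hc)) (lt_irrefl _)

/-- Linearizes a power near 1 with an error proportional to u, so that summable or small u produce
summable or small errors. -/
theorem one_add_rpow_le {u r : ℝ} (hu : 0 ≤ u) (hr : 0 ≤ r) :
    (1 + u) ^ r ≤ 1 + r * u * Real.exp (r * u) := by
  have h1 : (1 + u) ^ r ≤ Real.exp (r * u) := by
    calc (1 + u) ^ r ≤ (Real.exp u) ^ r :=
          Real.rpow_le_rpow (by linarith) (by linarith [Real.add_one_le_exp u]) hr
      _ = Real.exp (r * u) := by rw [← Real.exp_mul, mul_comm]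
  have h2 := Real.add_one_le_exp (-(r * u))
  have h3 : Real.exp (r * u) * Real.exp (-(r * u)) = 1 := by rw [← Real.exp_add]; simp
  nlinarith [Real.exp_pos (r * u)]

/-! ### Integrals of the part of a function above a level. -/

/-- The part of a `[0, ∞]`-value above the level `s`. -/
noncomputable def partAbove (s r : ℝ≥0∞) : ℝ≥0∞ := by
  classical exact if s < r then r else 0

theorem partAbove_of_lt {s r : ℝ≥0∞} (h : s < r) : partAbove s r = r := by
  simp [partAbove, h]

theorem partAbove_of_le {s r : ℝ≥0∞} (h : r ≤ s) : partAbove s r = 0 := by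
  simp [partAbove, not_lt.2 h]

theorem partAbove_le (s r : ℝ≥0∞) : partAbove s r ≤ r := by
  rcases lt_or_ge s r with h | h
  · rw [partAbove_of_lt h]
  · rw [partAbove_of_le h]; exact zero_le

theorem partAbove_monotone (s : ℝ≥0∞) : Monotone (partAbove s) := by
  intro r r' h
  rcases lt_or_ge s r with h1 | h1
  · rw [partAbove_of_lt h1, partAbove_of_lt (h1.trans_le h)]; exact h
  · rw [partAbove_of_le h1]; exact zero_le

theorem le_min_add_partAbove (s r : ℝ≥0∞) : r ≤ min r s + partAbove s r := by
  rcases lt_or_ge s r with h | h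
  · rw [partAbove_of_lt h]; exact le_add_self
  · rw [min_eq_left h]; exact le_self_add

theorem measurable_partAbove (s : ℝ≥0∞) : Measurable (partAbove s) :=
  (partAbove_monotone s).measurable

theorem lintegral_Ioo_rpow {b c T : ℝ} (hb : b < 1) (hc : 0 ≤ c) (hT : 0 < T) :
    ∫⁻ t in Ioo 0 T, ENNReal.ofReal (c * t ^ (-b)) = ENNReal.ofReal (c * T ^ (1 - b) / (1 - b)) := by
  have hi : IntervalIntegrable (fun t : ℝ => c * t ^ (-b)) volume 0 T :=
    (intervalIntegral.intervalIntegrable_rpow' (by linarith)).const_mul c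
  rw [← ofReal_integral_eq_lintegral_ofReal, ← integral_Ioc_eq_integral_Ioo,
    ← intervalIntegral.integral_of_le hT.le, intervalIntegral.integral_const_mul,
    integral_rpow (Or.inl (by linarith))]
  · rw [show -b + 1 = 1 - b by ring, Real.zero_rpow (by linarith), sub_zero, mul_div_assoc]
  · exact (((intervalIntegrable_iff_integrableOn_Ioo_of_le hT.le).1 hi))
  · refine (ae_restrict_iff' measurableSet_Ioo).2 (.of_forall fun t ht => ?_)
    exact mul_nonneg hc (Real.rpow_nonneg ht.1.le _)

/-- A weak-type bound of exponent q makes powers a < q integrable near mass zero; the part above the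
level attached to T only sees the rearrangement on (0, T). -/
theorem lintegral_partAbove_rpow_le {X : Type*} [MeasurableSpace X] {μ : Measure X} [SFinite μ]
    {g : X → ℝ≥0∞} (hg : Measurable g) {q a c T : ℝ} (hq : 0 < q) (ha : 0 < a) (haq : a < q)
    (hc : 0 < c) (hT : 0 < T)
    (h : ∀ t : ℝ, 0 < t → t ≤ T →
      μ {x | ENNReal.ofReal (c * t ^ (-(1 / q))) < g x} ≤ ENNReal.ofReal t) :
    ∫⁻ x, partAbove (ENNReal.ofReal (c * T ^ (-(1 / q)))) (g x) ^ a ∂μ ≤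
      ENNReal.ofReal (c ^ a * T ^ (1 - a / q) / (1 - a / q)) := by
  set s := ENNReal.ofReal (c * T ^ (-(1 / q))) with hs
  -- Freezing the profile at T makes it equal to the cut level for t ≥ T, where `partAbove` then
  -- vanishes.
  set κ : ℝ → ℝ≥0∞ := fun t => ENNReal.ofReal (c * (min t T) ^ (-(1 / q))) with hκ
  have hκm : Measurable κ := by
    refine ENNReal.measurable_ofReal.comp (measurable_const.mul ?_)
    exact (measurable_id.min measurable_const).pow_const _
  have hdom : ∀ t : ℝ, 0 < t → μ {x | κ t < g x} ≤ ENNReal.ofReal t := by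
    intro t ht
    rcases le_total t T with h1 | h1
    · simpa [hκ, min_eq_left h1] using h t ht h1
    · have := h T hT le_rfl
      simp only [hκ, min_eq_right h1]
      exact this.trans (ENNReal.ofReal_le_ofReal h1)
  have hG : Monotone fun r => partAbove s r ^ a := fun r r' hr =>
    ENNReal.rpow_le_rpow (partAbove_monotone s hr) ha.le
  refine (lintegral_comp_le_of_rearr_le le_rfl hg hκm hdom le_top hG).trans ?_
  have hb : a / q < 1 := (div_lt_one hq).2 haq
  rw [← lintegral_Ioo_rpow hb (Real.rpow_nonneg hc.le a) hT,
    ← lintegral_indicator (measurableSet_pos_ofReal_lt _), ← lintegral_indicator measurableSet_Ioo]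
  refine lintegral_mono fun t => ?_
  by_cases ht : t ∈ {t : ℝ | 0 < t ∧ ENNReal.ofReal t < ⊤}
  swap
  · rw [indicator_of_notMem ht]; exact zero_le
  rw [indicator_of_mem ht]
  rcases lt_or_ge t T with h1 | h1
  · rw [indicator_of_mem (show t ∈ Ioo 0 T from ⟨ht.1, h1⟩)]
    refine (ENNReal.rpow_le_rpow (partAbove_le _ _) ha.le).trans ?_
    have h0 : 0 ≤ t ^ (-(1 / q)) := Real.rpow_nonneg ht.1.le _
    rw [hκ]
    simp only [min_eq_left h1.le]
    rw [ENNReal.ofReal_rpow_of_nonneg (mul_nonneg hc.le h0) ha.le, Real.mul_rpow hc.le h0,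
      ← Real.rpow_mul ht.1.le]
    refine le_of_eq ?_
    congr 3
    ring
  · rw [partAbove_of_le, ENNReal.zero_rpow_of_pos ha]
    · exact zero_le
    · simp only [hκ, min_eq_right h1, hs, le_refl]

/-! ### Energy of the kernel profile on the logarithmic scale. -/

section Logarithmic

variable {κ : ℝ → ℝ≥0∞} {β γ H : ℝ}

/-- Here |log t| ≥ j, so κ^β is at most 1/t times a factor close to 1, and dt/t gives each such
interval mass exactly 1. -/
theorem lintegral_Ioc_exp_succ_le (hβ : 0 < β) (hγ : 0 < γ) (hH : 0 ≤ H)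
    (h : ∀ t : ℝ, 0 < t → t ≤ 1 →
      κ t ≤ ENNReal.ofReal (t ^ (-(1 / β)) * (1 + H * (1 + |Real.log t|) ^ (-γ)))) (j : ℕ) :
    ∫⁻ t in Ioc (Real.exp (-(j + 1 : ℝ))) (Real.exp (-(j : ℝ))), κ t ^ β ≤
      ENNReal.ofReal (1 + β * H * Real.exp (β * H) * (1 + (j : ℝ)) ^ (-γ)) := by
  set c := 1 + β * H * Real.exp (β * H) * (1 + (j : ℝ)) ^ (-γ) with hc
  have hj0 : (0 : ℝ) ≤ j := Nat.cast_nonneg j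
  have hv0 : 0 ≤ (1 + (j : ℝ)) ^ (-γ) := Real.rpow_nonneg (by positivity) _
  have hv1 : (1 + (j : ℝ)) ^ (-γ) ≤ 1 :=
    Real.rpow_le_one_of_one_le_of_nonpos (by linarith) (by linarith)
  have hc0 : 0 ≤ c := by positivity
  have hlt : Real.exp (-(j + 1 : ℝ)) ≤ Real.exp (-(j : ℝ)) := Real.exp_le_exp.2 (by linarith)
  have hint : ∫⁻ t in Ioc (Real.exp (-(j + 1 : ℝ))) (Real.exp (-(j : ℝ))),
      ENNReal.ofReal (c * (1 / t)) = ENNReal.ofReal c := by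
    have h0 : (0 : ℝ) ∉ uIcc (Real.exp (-(j + 1 : ℝ))) (Real.exp (-(j : ℝ))) := by
      rw [uIcc_of_le hlt]
      exact fun hx => absurd hx.1 (not_le.2 (Real.exp_pos _))
    rw [← ofReal_integral_eq_lintegral_ofReal, ← intervalIntegral.integral_of_le hlt,
      intervalIntegral.integral_const_mul, integral_one_div h0, ← Real.exp_sub, Real.log_exp]
    · ring_nf
    · rw [← IntegrableOn, ← intervalIntegrable_iff_integrableOn_Ioc_of_le hlt]
      refine IntervalIntegrable.const_mul ?_ _
      exact intervalIntegral.intervalIntegrable_one_div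
        (fun x hx hx0 => h0 (hx0 ▸ hx)) continuousOn_id
    · refine (ae_restrict_iff' measurableSet_Ioc).2 (.of_forall fun t ht => ?_)
      have : 0 < t := (Real.exp_pos _).trans ht.1
      show (0 : ℝ) ≤ c * (1 / t)
      positivity
  rw [← hint]
  refine setLIntegral_mono' measurableSet_Ioc fun t ht => ?_
  have ht0 : 0 < t := (Real.exp_pos _).trans ht.1
  have hlog : Real.log t ≤ -j := by
    have := Real.log_le_log ht0 ht.2
    rwa [Real.log_exp] at this
  have ht1 : t ≤ 1 := ht.2.trans (Real.exp_le_one_iff.2 (by linarith))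
  have habs : (j : ℝ) ≤ |Real.log t| := by rw [abs_of_nonpos (by linarith)]; linarith
  have hpow : (1 + |Real.log t|) ^ (-γ) ≤ (1 + (j : ℝ)) ^ (-γ) :=
    Real.rpow_le_rpow_of_nonpos (by linarith) (by linarith) (by linarith)
  have htp : 0 ≤ t ^ (-(1 / β)) := Real.rpow_nonneg ht0.le _
  have h1 : κ t ≤ ENNReal.ofReal (t ^ (-(1 / β)) * (1 + H * (1 + (j : ℝ)) ^ (-γ))) := by
    refine (h t ht0 ht1).trans (ENNReal.ofReal_le_ofReal ?_)
    gcongr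
  refine (ENNReal.rpow_le_rpow h1 hβ.le).trans ?_
  rw [ENNReal.ofReal_rpow_of_nonneg (by positivity) hβ.le]
  refine ENNReal.ofReal_le_ofReal ?_
  rw [Real.mul_rpow htp (by positivity), ← Real.rpow_mul ht0.le,
    show -(1 / β) * β = -1 by field_simp, Real.rpow_neg_one, mul_comm, one_div]
  refine mul_le_mul_of_nonneg_right ?_ (by positivity)
  refine (one_add_rpow_le (by positivity) hβ.le).trans ?_
  have : Real.exp (β * (H * (1 + (j : ℝ)) ^ (-γ))) ≤ Real.exp (β * H) := by
    apply Real.exp_le_exp.2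
    have : H * (1 + (j : ℝ)) ^ (-γ) ≤ H * 1 := mul_le_mul_of_nonneg_left hv1 hH
    nlinarith
  rw [hc]
  have h2 : β * (H * (1 + (j : ℝ)) ^ (-γ)) * Real.exp (β * (H * (1 + (j : ℝ)) ^ (-γ))) ≤
    β * (H * (1 + (j : ℝ)) ^ (-γ)) * Real.exp (β * H) := by gcongr
  linarith

/-- The unit intervals contribute n - m, and their excesses are summable because γ > 1. The constant
serves every profile κ at once. -/
theorem exists_lintegral_Ioc_exp_le (hβ : 0 < β) (hγ : 1 < γ) (hH : 0 ≤ H) :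
    ∃ C : ℝ, 0 ≤ C ∧ ∀ κ : ℝ → ℝ≥0∞, (∀ t : ℝ, 0 < t → t ≤ 1 →
      κ t ≤ ENNReal.ofReal (t ^ (-(1 / β)) * (1 + H * (1 + |Real.log t|) ^ (-γ)))) →
      ∀ m n : ℕ, m ≤ n →
        ∫⁻ t in Ioc (Real.exp (-(n : ℝ))) (Real.exp (-(m : ℝ))), κ t ^ β ≤
          ENNReal.ofReal (n - m + C) := by
  set D := β * H * Real.exp (β * H)
  have hD : 0 ≤ D := by positivity
  have hsum : Summable fun j : ℕ => (1 + (j : ℝ)) ^ (-γ) := by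
    have := (summable_nat_add_iff 1).2 (Real.summable_nat_rpow.2 (show -γ < -1 by linarith))
    refine this.congr fun j => ?_
    push_cast
    rw [add_comm]
  have hnn : ∀ j : ℕ, 0 ≤ (1 + (j : ℝ)) ^ (-γ) := fun j => Real.rpow_nonneg (by positivity) _
  refine ⟨D * ∑' j : ℕ, (1 + (j : ℝ)) ^ (-γ), mul_nonneg hD (tsum_nonneg hnn), ?_⟩
  intro κ h m n hmn
  have key : ∫⁻ t in Ioc (Real.exp (-(n : ℝ))) (Real.exp (-(m : ℝ))), κ t ^ β ≤
      ENNReal.ofReal (n - m + D * ∑ j ∈ Finset.Ico m n, (1 + (j : ℝ)) ^ (-γ)) := by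
    induction n, hmn using Nat.le_induction with
    | base => simp
    | succ n hmn ih =>
      have hmn' : (m : ℝ) ≤ n := by exact_mod_cast hmn
      have hs : 0 ≤ ∑ j ∈ Finset.Ico m n, (1 + (j : ℝ)) ^ (-γ) :=
        Finset.sum_nonneg fun j _ => hnn j
      rw [← Ioc_union_Ioc_eq_Ioc (b := Real.exp (-(n : ℝ))) (Real.exp_le_exp.2 (by simp))
        (Real.exp_le_exp.2 (by linarith))]
      refine (lintegral_union_le _ _ _).trans ?_
      have h2 := lintegral_Ioc_exp_succ_le hβ (by linarith) hH h n
      push_cast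
      refine (add_le_add h2 ih).trans ?_
      rw [← ENNReal.ofReal_add (by have := hnn n; positivity)
        (add_nonneg (by linarith) (mul_nonneg hD hs)), Finset.sum_Ico_succ_top hmn]
      refine ENNReal.ofReal_le_ofReal (le_of_eq ?_)
      ring
  refine key.trans (ENNReal.ofReal_le_ofReal ?_)
  gcongr
  exact hsum.sum_le_tsum _ fun j _ => hnn j

end Logarithmic

/-! ### Energy of the kernel capped at a level. -/

/-- The kernel level `(1 + H) e^{n/β}` which a rearrangement bounded by `(1 + H) t^{-1/β}` can only
exceed on `(0, e^{-n})`. -/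
noncomputable def kernelLevel (β H : ℝ) (n : ℕ) : ℝ≥0∞ :=
  ENNReal.ofReal ((1 + H) * Real.exp (-(n : ℝ)) ^ (-(1 / β)))

/-- On (0, e^{-n}] the cap alone costs (1 + H)^β e^n · e^{-n}, a constant. -/
theorem lintegral_Ioc_min_kernelLevel_le {β H C : ℝ} (hβ : 0 < β) (hH : 0 ≤ H) (hC : 0 ≤ C)
    {κ : ℝ → ℝ≥0∞} {m n : ℕ} (hmn : m ≤ n)
    (h : ∫⁻ t in Ioc (Real.exp (-(n : ℝ))) (Real.exp (-(m : ℝ))), κ t ^ β ≤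
      ENNReal.ofReal (n - m + C)) :
    ∫⁻ t in Ioc 0 (Real.exp (-(m : ℝ))), min (κ t) (kernelLevel β H n) ^ β ≤
      ENNReal.ofReal (n - m + (C + (1 + H) ^ β)) := by
  have hmn' : (m : ℝ) ≤ n := by exact_mod_cast hmn
  rw [← Ioc_union_Ioc_eq_Ioc (Real.exp_pos (-(n : ℝ))).le (Real.exp_le_exp.2 (by linarith))]
  refine (lintegral_union_le _ _ _).trans ?_
  have h1 : ∫⁻ t in Ioc 0 (Real.exp (-(n : ℝ))), min (κ t) (kernelLevel β H n) ^ β ≤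
      ENNReal.ofReal ((1 + H) ^ β) := by
    calc _ ≤ ∫⁻ t in Ioc 0 (Real.exp (-(n : ℝ))), kernelLevel β H n ^ β :=
          lintegral_mono fun t => ENNReal.rpow_le_rpow (min_le_right _ _) hβ.le
      _ = ENNReal.ofReal ((1 + H) ^ β) := by
          have h0 : 0 ≤ Real.exp (-(n : ℝ)) ^ (-(1 / β)) := Real.rpow_nonneg (Real.exp_pos _).le _
          rw [setLIntegral_const, Real.volume_Ioc, kernelLevel,
            ENNReal.ofReal_rpow_of_nonneg (by positivity) hβ.le, sub_zero,
            ← ENNReal.ofReal_mul (by positivity), Real.mul_rpow (by positivity) h0,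
            ← Real.rpow_mul (Real.exp_pos _).le, show -(1 / β) * β = -1 by field_simp,
            Real.rpow_neg_one, mul_assoc, inv_mul_cancel₀ (Real.exp_pos _).ne', mul_one]
  have h2 : ∫⁻ t in Ioc (Real.exp (-(n : ℝ))) (Real.exp (-(m : ℝ))),
      min (κ t) (kernelLevel β H n) ^ β ≤ ENNReal.ofReal (n - m + C) :=
    (lintegral_mono fun t => ENNReal.rpow_le_rpow (min_le_left _ _) hβ.le).trans h
  refine (add_le_add h1 h2).trans ?_
  rw [← ENNReal.ofReal_add (by positivity) (by linarith)]
  exact ENNReal.ofReal_le_ofReal (by linarith)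

theorem min_rpow_monotone {β : ℝ} (hβ : 0 ≤ β) (s : ℝ≥0∞) :
    Monotone fun r : ℝ≥0∞ => min r s ^ β := fun _ _ hr =>
  ENNReal.rpow_le_rpow (min_le_min_right s hr) hβ

section

variable {X : Type*} [MeasurableSpace X] {μ : Measure X} {g : X → ℝ≥0∞} {κ : ℝ → ℝ≥0∞}
  {β H C : ℝ}

theorem lintegral_min_kernelLevel_le_of_mass_le {μ' : Measure X} [SFinite μ'] (hle : μ' ≤ μ)
    (hg : Measurable g) (hκ : Measurable κ)
    (hdom : ∀ t : ℝ, 0 < t → μ {x | κ t < g x} ≤ ENNReal.ofReal t)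
    (hβ : 0 < β) (hH : 0 ≤ H) (hC : 0 ≤ C) {m n : ℕ} (hmn : m ≤ n)
    (hmass : μ' univ ≤ ENNReal.ofReal (Real.exp (-(m : ℝ))))
    (h : ∫⁻ t in Ioc (Real.exp (-(n : ℝ))) (Real.exp (-(m : ℝ))), κ t ^ β ≤
      ENNReal.ofReal (n - m + C)) :
    ∫⁻ x, min (g x) (kernelLevel β H n) ^ β ∂μ' ≤
      ENNReal.ofReal (n - m + (C + (1 + H) ^ β)) := by
  refine (lintegral_comp_le_of_rearr_le hle hg hκ hdom hmass (min_rpow_monotone hβ.le _)).trans ?_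
  refine le_trans (lintegral_mono_set fun t ht => ?_)
    (lintegral_Ioc_min_kernelLevel_le hβ hH hC hmn h)
  exact ⟨ht.1, ((ENNReal.ofReal_lt_ofReal_iff (Real.exp_pos _)).1 ht.2).le⟩

theorem lintegral_min_kernelLevel_le [SFinite μ]
    (hg : Measurable g) (hκ : Measurable κ)
    (hdom : ∀ t : ℝ, 0 < t → μ {x | κ t < g x} ≤ ENNReal.ofReal t)
    (hβ : 0 < β) (hH : 0 ≤ H) (hC : 0 ≤ C) (n : ℕ)
    (h : ∫⁻ t in Ioc (Real.exp (-(n : ℝ))) (Real.exp (-((0 : ℕ) : ℝ))), κ t ^ β ≤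
      ENNReal.ofReal (n - (0 : ℕ) + C)) :
    ∫⁻ x, min (g x) (kernelLevel β H n) ^ β ∂μ ≤
      ENNReal.ofReal (n + (C + (1 + H) ^ β)) + ∫⁻ t in Ioi 1, κ t ^ β := by
  refine (lintegral_comp_le_of_rearr_le le_rfl hg hκ hdom le_top
    (min_rpow_monotone hβ.le _)).trans ?_
  have h0 := lintegral_Ioc_min_kernelLevel_le hβ hH hC (Nat.zero_le n) h
  simp only [Nat.cast_zero, neg_zero, Real.exp_zero, sub_zero] at h0
  refine le_trans (lintegral_mono_set (t := Ioc 0 1 ∪ Ioi 1) fun t ht => ?_) ?_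
  · rw [Ioc_union_Ioi_eq_Ioi zero_le_one]; exact ht.1
  refine (lintegral_union_le _ _ _).trans (add_le_add h0 ?_)
  exact lintegral_mono fun t => ENNReal.rpow_le_rpow (min_le_left _ _) hβ.le

end

/-! ### Weights selecting the largest values of f, allowing for atoms. -/

section Weights

variable {X : Type*} [MeasurableSpace X] (μ : Measure X) (f : X → ℝ≥0∞)

/-- The share of the level set `{f = ρ}`, `ρ` the rearrangement of `f` at `T`, which completes
`{f > ρ}` to mass `T`. -/
noncomputable def levelShare (T : ℝ≥0∞) : ℝ≥0∞ :=
  min 1 ((T - μ {x | upperLevel μ f T < f x}) / μ {x | f x = upperLevel μ f T})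

/-- A weight with values in `[0, 1]` selecting the largest values of `f` up to mass `T`. -/
noncomputable def topWeight (T : ℝ≥0∞) (x : X) : ℝ≥0∞ := by
  classical exact if upperLevel μ f T < f x then 1
    else if f x = upperLevel μ f T then levelShare μ f T else 0

variable {μ f}

theorem topWeight_of_lt {T : ℝ≥0∞} {x : X} (h : upperLevel μ f T < f x) :
    topWeight μ f T x = 1 := by simp [topWeight, h]

theorem topWeight_of_eq {T : ℝ≥0∞} {x : X} (h : f x = upperLevel μ f T) :
    topWeight μ f T x = levelShare μ f T := by simp [topWeight, h]

theorem topWeight_of_gt {T : ℝ≥0∞} {x : X} (h : f x < upperLevel μ f T) :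
    topWeight μ f T x = 0 := by simp [topWeight, h.not_gt, h.ne]

theorem topWeight_le_one (T : ℝ≥0∞) (x : X) : topWeight μ f T x ≤ 1 := by
  rcases lt_trichotomy (f x) (upperLevel μ f T) with h | h | h
  · rw [topWeight_of_gt h]; exact zero_le
  · rw [topWeight_of_eq h]; exact min_le_left _ _
  · rw [topWeight_of_lt h]

theorem topWeight_eq_indicator (T : ℝ≥0∞) : topWeight μ f T = fun x =>
    {x | upperLevel μ f T < f x}.indicator (fun _ => 1) x +
      {x | f x = upperLevel μ f T}.indicator (fun _ => levelShare μ f T) x := by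
  ext x
  rcases lt_trichotomy (f x) (upperLevel μ f T) with h | h | h
  · simp [topWeight_of_gt h, h.ne, h.not_gt]
  · simp [topWeight_of_eq h, h]
  · simp [topWeight_of_lt h, h, h.ne']

theorem measurable_topWeight (hf : Measurable f) (T : ℝ≥0∞) : Measurable (topWeight μ f T) := by
  rw [topWeight_eq_indicator]
  exact (measurable_const.indicator (measurableSet_lt measurable_const hf)).add
    (measurable_const.indicator (measurableSet_eq_fun hf measurable_const))

theorem lintegral_topWeight (hf : Measurable f) (T : ℝ≥0∞) :
    ∫⁻ x, topWeight μ f T x ∂μ = μ {x | upperLevel μ f T < f x} +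
      levelShare μ f T * μ {x | f x = upperLevel μ f T} := by
  rw [topWeight_eq_indicator, lintegral_add_left
    (measurable_const.indicator (measurableSet_lt measurable_const hf)),
    lintegral_indicator_const (measurableSet_lt measurable_const hf),
    lintegral_indicator_const (measurableSet_eq_fun hf measurable_const), one_mul]

theorem lintegral_topWeight_le (hf : Measurable f) (T : ℝ≥0∞) :
    ∫⁻ x, topWeight μ f T x ∂μ ≤ T := by
  rw [lintegral_topWeight hf]
  have h1 : levelShare μ f T * μ {x | f x = upperLevel μ f T} ≤
      T - μ {x | upperLevel μ f T < f x} :=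
    (mul_le_mul_left (min_le_right _ _) _).trans (by rw [mul_comm]; exact ENNReal.mul_div_le)
  calc _ ≤ μ {x | upperLevel μ f T < f x} + (T - μ {x | upperLevel μ f T < f x}) := by gcongr
    _ = T := add_tsub_cancel_of_le (measure_upperLevel_lt_le μ f T)

/-- If the level drops strictly, the larger weight is already 1 wherever the smaller one is nonzero;
if it stays, only the share of the level set grows. -/
theorem topWeight_mono {T T' : ℝ≥0∞} (h : T' ≤ T) (x : X) :
    topWeight μ f T' x ≤ topWeight μ f T x := by
  rcases (upperLevel_antitone μ f h).eq_or_lt with h1 | h1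
  · have h2 : levelShare μ f T' ≤ levelShare μ f T := by
      unfold levelShare
      rw [h1]
      gcongr
    rcases lt_trichotomy (f x) (upperLevel μ f T') with h3 | h3 | h3
    · rw [topWeight_of_gt h3]; exact zero_le
    · rw [topWeight_of_eq h3, topWeight_of_eq (h3.trans h1.symm)]; exact h2
    · rw [topWeight_of_lt (h1.symm ▸ h3 : upperLevel μ f T < f x)]; exact topWeight_le_one _ _
  · rcases lt_or_ge (f x) (upperLevel μ f T') with h3 | h3
    · rw [topWeight_of_gt h3]; exact zero_le
    · rw [topWeight_of_lt (h1.trans_le h3)]; exact topWeight_le_one _ _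

theorem one_sub_topWeight_mul_le (T : ℝ≥0∞) (x : X) :
    (1 - topWeight μ f T x) * f x ≤ upperLevel μ f T := by
  rcases lt_or_ge (upperLevel μ f T) (f x) with h | h
  · simp [topWeight_of_lt h]
  · exact (mul_le_of_le_one_left' tsub_le_self).trans h

theorem measure_ge_lt_top {p : ℝ} (hp : 0 < p) (hf : Measurable f) (hfp : ∫⁻ x, f x ^ p ∂μ ≠ ⊤)
    {s : ℝ≥0∞} (hs : s ≠ 0) : μ {x | s ≤ f x} ≠ ⊤ := by
  have h := mul_meas_ge_le_lintegral (μ := μ) (hf.pow_const p) (s ^ p)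
  have : {x | s ^ p ≤ f x ^ p} = {x | s ≤ f x} := by
    ext x; simp [ENNReal.rpow_le_rpow_iff hp]
  rw [this] at h
  intro htop
  rw [htop, ENNReal.mul_top] at h
  · exact hfp (top_le_iff.1 h)
  · simp [ENNReal.rpow_eq_zero_iff, hs, hp.not_gt]

/-- At a nonzero level the weight fills its whole mass: {f ≥ ρ} is a decreasing limit of sets of
measure above T, with finite measure by Chebyshev. At level 0 the function may be too small to fill
T. -/
theorem le_lintegral_topWeight {p : ℝ} (hp : 0 < p) (hf : Measurable f)
    (hfp : ∫⁻ x, f x ^ p ∂μ ≠ ⊤) {T : ℝ≥0∞} (hρ : upperLevel μ f T ≠ 0) :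
    T ≤ ∫⁻ x, topWeight μ f T x ∂μ := by
  set ρ := upperLevel μ f T with hρd
  have hge : T ≤ μ {x | ρ ≤ f x} := by
    obtain ⟨u, hu, hu', hlim⟩ := exists_seq_strictMono_tendsto' (pos_iff_ne_zero.2 hρ)
    have hI : {x | ρ ≤ f x} = ⋂ n, {x | u n < f x} := by
      ext x
      simp only [mem_ofPred_eq, mem_iInter]
      constructor
      · intro hx n
        exact (hu' n).2.trans_le hx
      · intro hx
        exact le_of_tendsto' hlim fun n => (hx n).le
    rw [hI, Antitone.measure_iInter]
    · exact le_iInf fun n => (measure_le_of_lt_upperLevel (hu' n).2).le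
    · intro m n hmn x hx
      exact (hu.monotone hmn).trans_lt hx
    · exact fun n => (measurableSet_lt measurable_const hf).nullMeasurableSet
    · refine ⟨0, ne_top_of_le_ne_top (measure_ge_lt_top hp hf hfp (hu' 0).1.ne') ?_⟩
      exact measure_mono fun x (hx : u 0 < f x) => le_of_lt hx
  have hsplit : μ {x | ρ ≤ f x} = μ {x | ρ < f x} + μ {x | f x = ρ} := by
    rw [← measure_union _ (measurableSet_eq_fun hf measurable_const)]
    · congr 1
      ext x
      simp [le_iff_lt_or_eq, eq_comm]
    · rw [Set.disjoint_left]
      intro x hx hx'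
      exact absurd hx' (ne_of_gt hx)
  have hfin : μ {x | f x = ρ} ≠ ⊤ :=
    ne_top_of_le_ne_top (measure_ge_lt_top hp hf hfp hρ) (measure_mono fun x hx => ge_of_eq hx)
  rw [lintegral_topWeight hf, ← hρd]
  rcases le_total 1 ((T - μ {x | ρ < f x}) / μ {x | f x = ρ}) with h1 | h1
  · rw [levelShare, ← hρd, min_eq_left h1, one_mul, ← hsplit]
    exact hge
  · rw [levelShare, ← hρd, min_eq_right h1]
    -- A null level set may have share 0/0 = 0, but then {f > ρ} alone already has mass T.
    rcases eq_or_ne (μ {x | f x = ρ}) 0 with h0 | h0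
    · rw [hsplit, h0, add_zero] at hge
      exact hge.trans le_self_add
    · rw [ENNReal.div_mul_cancel h0 hfin, add_tsub_cancel_of_le (measure_upperLevel_lt_le μ f T)]

/-- The weight lives where f ≥ ρ and has mass T if ρ ≠ 0. This turns the pointwise bound f ≤ ρ
outside the selected part into a bound by Φ^{1/p}. -/
theorem upperLevel_rpow_mul_le {p : ℝ} (hp : 0 < p) (hf : Measurable f)
    (hfp : ∫⁻ x, f x ^ p ∂μ ≠ ⊤) (T : ℝ≥0∞) :
    upperLevel μ f T ^ p * T ≤ ∫⁻ x, topWeight μ f T x * f x ^ p ∂μ := by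
  rcases eq_or_ne (upperLevel μ f T) 0 with h0 | h0
  · rw [h0, ENNReal.zero_rpow_of_pos hp, zero_mul]; exact zero_le
  calc _ ≤ upperLevel μ f T ^ p * ∫⁻ x, topWeight μ f T x ∂μ := by
        gcongr; exact le_lintegral_topWeight hp hf hfp h0
    _ = ∫⁻ x, upperLevel μ f T ^ p * topWeight μ f T x ∂μ :=
        (lintegral_const_mul _ (measurable_topWeight hf T)).symm
    _ ≤ _ := by
        refine lintegral_mono fun x => ?_
        rcases lt_or_ge (f x) (upperLevel μ f T) with h | h
        · simp [topWeight_of_gt h]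
        · rw [mul_comm]; gcongr

end Weights

/-! ### The discrete Adams lemma. -/

theorem add_mul_le_rpow_mul_rpow {β p x y z u v w : ℝ} (hp : β.HolderConjugate p)
    (hx : 0 ≤ x) (hy : 0 ≤ y) (hz : 0 ≤ z) (hu : 0 ≤ u) (hv : 0 ≤ v) (hw : 0 ≤ w) :
    x * u + y * v + z * w ≤
      (x ^ β + y ^ β + z ^ β) ^ (1 / β) * (u ^ p + v ^ p + w ^ p) ^ (1 / p) := by
  have := Real.inner_le_Lp_mul_Lq_of_nonneg (Finset.univ : Finset (Fin 3)) (f := ![x, y, z])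
    (g := ![u, v, w]) hp (by intro i _; fin_cases i <;> simpa) (by intro i _; fin_cases i <;> simpa)
  simpa [Fin.sum_univ_three] using this

/-- If any two indices at which `a` is at most `l` are `R (1 + l)`-close, unless the smaller one
is at most `R (1 + l)`, then `∑ exp (-σ a n)` is bounded in terms of `σ` and `R`. -/
theorem exists_tsum_exp_neg_le {σ R : ℝ} (hσ : 0 < σ) (hR : 0 < R) :
    ∃ C : ℝ, 0 < C ∧ ∀ a : ℕ → ℝ, (∀ n, 0 ≤ a n) →
      (∀ l : ℝ, ∀ m n : ℕ, m < n → a m ≤ l → a n ≤ l →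
        (m : ℝ) ≤ R * (1 + l) ∨ (n : ℝ) - m ≤ R * (1 + l)) →
      ∑' n, ENNReal.ofReal (Real.exp (-σ * a n)) ≤ ENNReal.ofReal C := by
  set r := Real.exp (-σ) with hr
  have hr0 : 0 < r := Real.exp_pos _
  have hr1 : r < 1 := by rw [hr, ← Real.exp_zero]; exact Real.exp_lt_exp.2 (by linarith)
  have hrn : ‖r‖ < 1 := by rwa [Real.norm_of_nonneg hr0.le]
  set cnt : ℕ → ℝ := fun l => 2 * R * (l + 2) + 2 with hcnt
  have hcnt0 : ∀ l, 0 ≤ cnt l := fun l => by positivity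
  have hsum : Summable fun l : ℕ => r ^ l * cnt l := by
    have h1 := (summable_pow_mul_geometric_of_norm_lt_one 1 hrn).mul_left (2 * R)
    have h0 := (summable_pow_mul_geometric_of_norm_lt_one 0 hrn).mul_left (4 * R + 2)
    refine (h1.add h0).congr fun l => ?_
    simp only [hcnt]
    ring
  have hnn : ∀ l : ℕ, 0 ≤ r ^ l * cnt l := fun l => mul_nonneg (pow_nonneg hr0.le _) (hcnt0 l)
  refine ⟨(∑' l : ℕ, r ^ l * cnt l) + 1, add_pos_of_nonneg_of_pos (tsum_nonneg hnn) one_pos, ?_⟩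
  intro a ha hpair
  have hcount : ∀ l : ℕ, ∑' n, {n : ℕ | a n ≤ l + 1}.indicator (fun _ => (1 : ℝ≥0∞)) n ≤
      ENNReal.ofReal (cnt l) := by
    intro l
    set L : ℕ := ⌊R * (1 + (l + 1 : ℝ))⌋₊ with hL
    have hLle : (L : ℝ) ≤ R * (1 + (l + 1 : ℝ)) := Nat.floor_le (by positivity)
    -- With n₀ the first admissible index beyond L, the hypothesis confines all admissible indices
    -- to [0, L] ∪ [n₀, n₀ + L].
    obtain ⟨F, hF, hFc⟩ : ∃ F : Finset ℕ, (∀ n, a n ≤ l + 1 → n ∈ F) ∧ F.card ≤ 2 * (L + 1) := by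
      by_cases hex : ∃ n, L < n ∧ a n ≤ l + 1
      · classical
        obtain ⟨hn1, hn2⟩ := Nat.find_spec hex
        set n₀ := Nat.find hex
        refine ⟨Finset.Icc 0 L ∪ Finset.Icc n₀ (n₀ + L), ?_, ?_⟩
        · intro n hn
          rw [Finset.mem_union, Finset.mem_Icc, Finset.mem_Icc]
          by_cases hnL : n ≤ L
          · exact Or.inl ⟨Nat.zero_le _, hnL⟩
          right
          have h1 : n₀ ≤ n := Nat.find_min' hex ⟨not_le.1 hnL, hn⟩
          refine ⟨h1, ?_⟩
          rcases h1.eq_or_lt with h2 | h2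
          · omega
          rcases hpair _ _ _ h2 hn2 hn with h3 | h3
          · exact absurd (Nat.le_floor h3) (not_le.2 hn1)
          · have : ((n - n₀ : ℕ) : ℝ) ≤ R * (1 + (l + 1 : ℝ)) := by
              rw [Nat.cast_sub h1]; exact h3
            have := Nat.le_floor this
            omega
        · refine (Finset.card_union_le _ _).trans ?_
          simp only [Nat.card_Icc]
          omega
      · push Not at hex
        refine ⟨Finset.Icc 0 L, ?_, ?_⟩
        · intro n hn
          rw [Finset.mem_Icc]
          refine ⟨Nat.zero_le _, ?_⟩
          by_contra! h
          exact absurd hn (not_le.2 (hex n h))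
        · simp only [Nat.card_Icc]
          omega
    calc ∑' n, {n : ℕ | a n ≤ l + 1}.indicator (fun _ => (1 : ℝ≥0∞)) n
        = ∑ n ∈ F, {n : ℕ | a n ≤ l + 1}.indicator (fun _ => (1 : ℝ≥0∞)) n := by
          refine tsum_eq_sum fun n hn => ?_
          exact indicator_of_notMem (s := {n : ℕ | a n ≤ l + 1}) (fun h => hn (hF n h)) _
      _ ≤ ∑ n ∈ F, 1 := by
          refine Finset.sum_le_sum fun n _ => ?_
          exact indicator_le_self' (fun _ _ => zero_le) _
      _ = (F.card : ℝ≥0∞) := by simp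
      _ = ENNReal.ofReal (F.card : ℝ) := (ENNReal.ofReal_natCast _).symm
      _ ≤ _ := by
          refine ENNReal.ofReal_le_ofReal ?_
          have : (F.card : ℝ) ≤ 2 * (L + 1) := by exact_mod_cast hFc
          simp only [hcnt]
          linarith
  calc ∑' n, ENNReal.ofReal (Real.exp (-σ * a n))
      ≤ ∑' n, ∑' l : ℕ, ENNReal.ofReal (r ^ l) *
          {n : ℕ | a n ≤ l + 1}.indicator (fun _ => (1 : ℝ≥0∞)) n := by
        refine ENNReal.tsum_le_tsum fun n => ?_
        refine le_trans ?_ (ENNReal.le_tsum ⌊a n⌋₊)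
        rw [indicator_of_mem (show n ∈ {k : ℕ | a k ≤ (⌊a n⌋₊ : ℝ) + 1} from
          (Nat.lt_floor_add_one (a n)).le), mul_one, hr, ← Real.exp_nat_mul]
        refine ENNReal.ofReal_le_ofReal (Real.exp_le_exp.2 ?_)
        nlinarith [Nat.floor_le (ha n)]
    _ = ∑' l : ℕ, ENNReal.ofReal (r ^ l) *
          ∑' n, {n : ℕ | a n ≤ l + 1}.indicator (fun _ => (1 : ℝ≥0∞)) n := by
        rw [ENNReal.tsum_comm]
        simp_rw [ENNReal.tsum_mul_left]
    _ ≤ ∑' l : ℕ, ENNReal.ofReal (r ^ l * cnt l) := by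
        refine ENNReal.tsum_le_tsum fun l => ?_
        rw [ENNReal.ofReal_mul (pow_nonneg hr0.le _)]
        gcongr
        exact hcount l
    _ = ENNReal.ofReal (∑' l : ℕ, r ^ l * cnt l) := (ENNReal.ofReal_tsum_of_nonneg hnn hsum).symm
    _ ≤ _ := ENNReal.ofReal_le_ofReal (by linarith)

section Sequence

variable {β p : ℝ}

/-- Beyond the threshold (2pc)^β the sublinear term is at most half of Y/p and is absorbed. -/
theorem le_of_div_le_add_mul_rpow (hp : β.HolderConjugate p) {c l Y : ℝ} (hc : 0 ≤ c)
    (hl : 0 ≤ l) (hY : 0 ≤ Y) (h : Y / p ≤ l + c * Y ^ (1 / p)) :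
    Y ≤ ((2 * p * c) ^ β + 2 * p) * (1 + l) := by
  have hp0 := hp.symm.pos
  have hβ0 := hp.pos
  have hpow : 0 ≤ (2 * p * c) ^ β := by positivity
  rcases le_total Y ((2 * p * c) ^ β) with h1 | h1
  · nlinarith [mul_nonneg hpow hl, mul_nonneg hp0.le hl]
  · have h2 : 2 * p * c ≤ Y ^ (1 / β) := by
      have := Real.rpow_le_rpow hpow h1 (show 0 ≤ 1 / β by positivity)
      rwa [← Real.rpow_mul (by positivity), mul_one_div_cancel hβ0.ne', Real.rpow_one] at this
    have h3 : Y ^ (1 / β) * Y ^ (1 / p) = Y := by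
      have hinv : 1 / β + 1 / p = 1 := by
        simpa [one_div] using hp.inv_add_inv_eq_one
      rw [← Real.rpow_add_of_nonneg hY (by positivity) (by positivity), hinv, Real.rpow_one]
    have h4 : 2 * p * c * Y ^ (1 / p) ≤ Y := by
      calc _ ≤ Y ^ (1 / β) * Y ^ (1 / p) :=
            mul_le_mul_of_nonneg_right h2 (Real.rpow_nonneg hY _)
        _ = Y := h3
    have h5 : Y ≤ p * (l + c * Y ^ (1 / p)) := by
      rwa [div_le_iff₀ hp0, mul_comm] at h
    nlinarith [mul_nonneg hpow hl, mul_nonneg hp0.le hl]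

/-- Stability in Hölder's inequality: the loss from (1 - φ)^{1/p} ≤ 1 - φ/p must be paid by the
defect l and the term c φ^{1/p}. Multiplying by N^{1/p} leaves an inequality in Y = Nφ. -/
theorem mul_le_of_sub_le_rpow (hp : β.HolderConjugate p) {c l N φ h : ℝ} (hc : 0 ≤ c)
    (hl : 0 ≤ l) (hN : 0 < N) (hφ : 0 ≤ φ) (hφ1 : φ ≤ 1) (hh : 0 ≤ h) (hN' : N - l ≤ h ^ β)
    (hle : h ≤ N ^ (1 / β) * (1 - φ) ^ (1 / p) + c * φ ^ (1 / p)) :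
    N * φ ≤ ((2 * p * c) ^ β + 2 * p) * (1 + l) := by
  have hp0 := hp.symm.pos
  have hp1 := hp.symm.lt
  have hβ0 := hp.pos
  have hβ1 := hp.lt
  have hinv : 1 / β + 1 / p = 1 := by simpa [one_div] using hp.inv_add_inv_eq_one
  refine le_of_div_le_add_mul_rpow hp hc hl (by positivity) ?_
  have hc' : 0 ≤ c * (N * φ) ^ (1 / p) := by positivity
  rcases le_total N l with h1 | h1
  · have : N * φ / p ≤ N * φ := div_le_self (by positivity) hp1.le
    nlinarith
  have h2 : N ^ (1 / β) * (1 - l / N) ≤ h := by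
    calc N ^ (1 / β) * (1 - l / N) ≤ N ^ (1 / β) * (1 - l / N) ^ (1 / β) := by
          gcongr
          have h3 : 0 ≤ 1 - l / N := by rw [sub_nonneg, div_le_one hN]; exact h1
          conv_lhs => rw [← Real.rpow_one (1 - l / N)]
          refine Real.rpow_le_rpow_of_exponent_ge_of_imp h3 (by
            have : 0 ≤ l / N := by positivity
            linarith) ?_ ?_
          · rw [div_le_one hβ0]; exact hβ1.le
          · intro _ h0; simp at h0
      _ = (N - l) ^ (1 / β) := by
          have h3 : 0 ≤ 1 - l / N := by rw [sub_nonneg, div_le_one hN]; exact h1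
          rw [← Real.mul_rpow hN.le h3]
          congr 1
          field_simp
      _ ≤ (h ^ β) ^ (1 / β) := Real.rpow_le_rpow (by linarith) hN' (by positivity)
      _ = h := by rw [← Real.rpow_mul hh, mul_one_div_cancel hβ0.ne', Real.rpow_one]
  have h3 : (1 - φ) ^ (1 / p) ≤ 1 - φ / p := by
    have := rpow_one_add_le_one_add_mul_self (s := -φ) (by linarith) (p := 1 / p) (by positivity)
      (by rw [div_le_one hp0]; exact hp1.le)
    rw [show 1 - φ / p = 1 + 1 / p * -φ by ring, sub_eq_add_neg]
    exact this
  have hNb : 0 < N ^ (1 / β) := Real.rpow_pos_of_pos hN _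
  have hNp : 0 < N ^ (1 / p) := Real.rpow_pos_of_pos hN _
  have hNN : N ^ (1 / β) * N ^ (1 / p) = N := by
    rw [← Real.rpow_add hN, hinv, Real.rpow_one]
  have h4 : N ^ (1 / β) * (1 - l / N) ≤ N ^ (1 / β) * (1 - φ / p) + c * φ ^ (1 / p) :=
    h2.trans (hle.trans (by gcongr))
  have h5 := mul_le_mul_of_nonneg_right h4 hNp.le
  rw [Real.mul_rpow hN.le hφ]
  have e1 : N ^ (1 / β) * (1 - l / N) * N ^ (1 / p) = N - l := by
    calc _ = (N ^ (1 / β) * N ^ (1 / p)) * (1 - l / N) := by ring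
      _ = N - l := by rw [hNN]; field_simp
  have e2 : (N ^ (1 / β) * (1 - φ / p) + c * φ ^ (1 / p)) * N ^ (1 / p) =
      N - N * φ / p + c * (N ^ (1 / p) * φ ^ (1 / p)) := by
    calc _ = (N ^ (1 / β) * N ^ (1 / p)) * (1 - φ / p) +
          c * (N ^ (1 / p) * φ ^ (1 / p)) := by ring
      _ = _ := by rw [hNN]; ring
  rw [e1, e2] at h5
  linarith

/-- Three-term Hölder with the weight 2^{1/β} moved onto φ halves the coefficient of d, so h^β grows
with slope below 1 in d once φ is small. -/
theorem rpow_le_of_le_add (hp : β.HolderConjugate p) {C₁ C₂ M d φ h : ℝ} (hC₁ : 0 ≤ C₁)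
    (hC₂ : 0 ≤ C₂) (hM : 0 ≤ M) (hd : 0 ≤ d) (hφ : 0 ≤ φ) (hφ1 : φ ≤ 1) (hh : 0 ≤ h)
    (hle : h ≤ M ^ (1 / β) + ((d + C₁) ^ (1 / β) + C₂) * φ ^ (1 / p)) :
    h ^ β ≤ (M + d / 2 + (C₁ / 2 + C₂ ^ β)) *
      (1 + (β - 1) * (2 ^ (p / β) + 1) * Real.exp ((β - 1) * (2 ^ (p / β) + 1)) * φ) := by
  have hp0 := hp.symm.pos
  have hβ0 := hp.pos
  have hβ1 : 0 < β - 1 := by linarith [hp.lt]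
  set b : ℝ := 2 ^ (p / β) + 1 with hb
  have hb0 : 0 < b := by positivity
  have key := add_mul_le_rpow_mul_rpow hp (x := M ^ (1 / β)) (y := ((d + C₁) / 2) ^ (1 / β))
    (z := C₂) (u := 1) (v := 2 ^ (1 / β) * φ ^ (1 / p)) (w := φ ^ (1 / p)) (by positivity)
    (by positivity) hC₂ zero_le_one (by positivity) (by positivity)
  have e0 : ((d + C₁) / 2) ^ (1 / β) * (2 ^ (1 / β) * φ ^ (1 / p)) =
      (d + C₁) ^ (1 / β) * φ ^ (1 / p) := by
    rw [← mul_assoc, ← Real.mul_rpow (by positivity) (by norm_num)]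
    congr 2
    ring
  have e1 : ∀ x : ℝ, 0 ≤ x → (x ^ (1 / β)) ^ β = x := fun x hx => by
    rw [← Real.rpow_mul hx, one_div_mul_cancel hβ0.ne', Real.rpow_one]
  have e2 : (φ ^ (1 / p)) ^ p = φ := by
    rw [← Real.rpow_mul hφ, one_div_mul_cancel hp0.ne', Real.rpow_one]
  have e3 : (2 ^ (1 / β) * φ ^ (1 / p)) ^ p = 2 ^ (p / β) * φ := by
    rw [Real.mul_rpow (by positivity) (by positivity), e2, ← Real.rpow_mul (by norm_num)]
    congr 2
    ring
  rw [e0, e1 M hM, e1 _ (by positivity), e2, e3, Real.one_rpow] at key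
  have h1 : h ≤ (M + (d + C₁) / 2 + C₂ ^ β) ^ (1 / β) * (1 + b * φ) ^ (1 / p) := by
    refine (hle.trans (le_of_eq ?_)).trans (key.trans (le_of_eq ?_))
    · ring
    · congr 2
      rw [hb]; ring
  have h2 := Real.rpow_le_rpow hh h1 hβ0.le
  have hCb : 0 ≤ C₂ ^ β := by positivity
  rw [Real.mul_rpow (by positivity) (by positivity), e1 _ (by positivity),
    ← Real.rpow_mul (by positivity)] at h2
  have hexp : 1 / p * β = β - 1 := by
    rw [one_div_mul_eq_div]; exact hp.div_conj_eq_sub_one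
  rw [hexp] at h2
  refine h2.trans ?_
  have h3 : (1 + b * φ) ^ (β - 1) ≤ 1 + (β - 1) * b * Real.exp ((β - 1) * b) * φ := by
    refine (one_add_rpow_le (by positivity) hβ1.le).trans ?_
    have : Real.exp ((β - 1) * (b * φ)) ≤ Real.exp ((β - 1) * b) := by
      apply Real.exp_le_exp.2
      have : b * φ ≤ b * 1 := mul_le_mul_of_nonneg_left hφ1 hb0.le
      nlinarith
    have h4 : (β - 1) * (b * φ) * Real.exp ((β - 1) * (b * φ)) ≤
      (β - 1) * (b * φ) * Real.exp ((β - 1) * b) := by gcongr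
    linarith
  calc _ ≤ (M + (d + C₁) / 2 + C₂ ^ β) * (1 + (β - 1) * b * Real.exp ((β - 1) * b) * φ) := by
        gcongr
    _ = _ := by ring

/-- Discrete form of Adams' lemma. -/
theorem exists_tsum_exp_rpow_sub_le (hp : β.HolderConjugate p) {σ C₁ C₂ : ℝ} (hσ : 0 < σ)
    (hC₁ : 0 < C₁) (hC₂ : 0 ≤ C₂) :
    ∃ C : ℝ, 0 < C ∧ ∀ (J : ℝ) (φ h : ℕ → ℝ), 0 ≤ J → (∀ n, 0 ≤ φ n) → (∀ n, φ n ≤ 1) →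
      (∀ n, 0 ≤ h n) →
      (∀ m n : ℕ, m ≤ n → h n ≤ (m + (C₁ + J)) ^ (1 / β) * (1 - φ m) ^ (1 / p) +
        ((n - m + C₁) ^ (1 / β) + C₂) * φ m ^ (1 / p)) →
      (∀ n, h n ^ β ≤ n + J + C) ∧
        ∑' n : ℕ, ENNReal.ofReal (Real.exp (σ * (h n ^ β - n))) ≤
          ENNReal.ofReal (C * Real.exp (σ * J)) := by
  have hp0 := hp.symm.pos
  have hβ0 := hp.pos
  have hβ1 : 0 < β - 1 := by linarith [hp.lt]
  set c := C₁ ^ (1 / β) + C₂ with hc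
  have hc0 : 0 ≤ c := by positivity
  set D := c ^ β with hD
  have hD0 : 0 ≤ D := by positivity
  set K := (2 * p * c) ^ β + 2 * p with hK
  have hK0 : 0 < K := by positivity
  set B := (β - 1) * (2 ^ (p / β) + 1) * Real.exp ((β - 1) * (2 ^ (p / β) + 1)) with hB
  have hB0 : 0 < B := by positivity
  set E := C₁ / 2 + C₂ ^ β with hE
  have hE0 : 0 ≤ E := by positivity
  -- Chosen so that M > R(1 + l) forces B φ_m ≤ 1/2, and so that the final comparison (n - m)/4 ≤
  -- (3/2)E + BK(1 + l) + l gives n - m ≤ R(1 + l).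
  set R := 6 * E + 4 * (B * K) + 4 with hR
  have hR0 : 0 < R := by positivity
  obtain ⟨S, hS0, hS⟩ := exists_tsum_exp_neg_le hσ hR0
  refine ⟨C₁ + D + Real.exp (σ * (C₁ + D)) * S, by positivity, ?_⟩
  intro J φ h hJ hφ0 hφ1 hh hmain
  clear_value c D K B E R
  have hdiag : ∀ n, h n ≤ (n + (C₁ + J)) ^ (1 / β) * (1 - φ n) ^ (1 / p) + c * φ n ^ (1 / p) := by
    intro n
    have := hmain n n le_rfl
    rwa [sub_self, zero_add, ← hc] at this
  have hupper : ∀ n, h n ^ β ≤ n + (C₁ + J) + D := by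
    intro n
    have h0 := hφ0 n
    have h1 : 0 ≤ 1 - φ n := by linarith [hφ1 n]
    have key := add_mul_le_rpow_mul_rpow hp (x := (n + (C₁ + J)) ^ (1 / β)) (y := c) (z := 0)
      (u := (1 - φ n) ^ (1 / p)) (v := φ n ^ (1 / p)) (w := 0) (by positivity) hc0 le_rfl
      (by positivity) (by positivity) le_rfl
    have e1 : (((n : ℝ) + (C₁ + J)) ^ (1 / β)) ^ β = n + (C₁ + J) := by
      rw [← Real.rpow_mul (by positivity), one_div_mul_cancel hβ0.ne', Real.rpow_one]
    have e2 : ∀ x : ℝ, 0 ≤ x → (x ^ (1 / p)) ^ p = x := fun x hx => by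
      rw [← Real.rpow_mul hx, one_div_mul_cancel hp0.ne', Real.rpow_one]
    rw [e1, e2 _ h0, e2 _ h1, Real.zero_rpow hβ0.ne', Real.zero_rpow hp0.ne', mul_zero, add_zero,
      add_zero, add_zero, sub_add_cancel, Real.one_rpow, mul_one] at key
    have := Real.rpow_le_rpow (hh n) ((hdiag n).trans key) hβ0.le
    rwa [← Real.rpow_mul (by positivity), one_div_mul_cancel hβ0.ne', Real.rpow_one, ← hD] at this
  -- The defect from maximal growth. It is measured from n + J, so the constants of the counting
  -- argument do not depend on J, which reappears only as the factor e^{σJ}.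
  set a : ℕ → ℝ := fun n => n + (C₁ + J) + D - h n ^ β with ha
  have ha0 : ∀ n, 0 ≤ a n := fun n => sub_nonneg.2 (hupper n)
  have hpair : ∀ l : ℝ, ∀ m n : ℕ, m < n → a m ≤ l → a n ≤ l →
      (m : ℝ) ≤ R * (1 + l) ∨ (n : ℝ) - m ≤ R * (1 + l) := by
    intro l m n hmn hm hn
    have hl : 0 ≤ l := (ha0 m).trans hm
    simp only [ha] at hm hn
    set M : ℝ := m + (C₁ + J) with hM
    have hM0 : 0 < M := by positivity
    have hd : 0 ≤ (n : ℝ) - m := by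
      have : (m : ℝ) ≤ n := by exact_mod_cast hmn.le
      linarith
    have hMφ : M * φ m ≤ K * (1 + l) := by
      rw [hK]
      exact mul_le_of_sub_le_rpow hp hc0 hl hM0 (hφ0 m) (hφ1 m) (hh m) (by linarith) (hdiag m)
    by_cases hbig : M ≤ R * (1 + l)
    · left
      linarith
    right
    push Not at hbig
    have hle : h n ≤ M ^ (1 / β) + ((n - m + C₁) ^ (1 / β) + C₂) * φ m ^ (1 / p) := by
      refine (hmain m n hmn.le).trans ?_
      gcongr
      refine mul_le_of_le_one_right (by positivity) ?_
      exact Real.rpow_le_one (by linarith [hφ1 m]) (by linarith [hφ0 m]) (by positivity)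
    have h1 := rpow_le_of_le_add hp hC₁.le hC₂ hM0.le hd (hφ0 m) (hφ1 m) (hh n) hle
    rw [← hB, ← hE] at h1
    have hBφ : M * (B * φ m) ≤ B * K * (1 + l) := by
      calc M * (B * φ m) = B * (M * φ m) := by ring
        _ ≤ B * (K * (1 + l)) := by gcongr
        _ = _ := by ring
    have hhalf : B * φ m ≤ 1 / 2 := by
      by_contra! hcon
      have : M * (1 / 2) < M * (B * φ m) := by gcongr
      have h2 : 2 * (B * K * (1 + l)) ≤ R * (1 + l) := by
        have h5 : 2 * (B * K) ≤ R := by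
          have := mul_pos hB0 hK0
          linarith
        calc 2 * (B * K * (1 + l)) = 2 * (B * K) * (1 + l) := by ring
          _ ≤ R * (1 + l) := mul_le_mul_of_nonneg_right h5 (by linarith)
      linarith
    have hBφ0 : 0 ≤ B * φ m := mul_nonneg hB0.le (hφ0 m)
    have h3 : ((n - m : ℝ) / 2 + E) * (B * φ m) ≤ ((n - m : ℝ) / 2 + E) * (1 / 2) := by
      gcongr
    have h4 : h n ^ β ≤ M + (n - m : ℝ) / 2 + E + B * K * (1 + l) +
        ((n - m : ℝ) / 2 + E) * (1 / 2) := by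
      calc h n ^ β ≤ (M + (n - m : ℝ) / 2 + E) * (1 + B * φ m) := h1
        _ = M + (n - m : ℝ) / 2 + E + M * (B * φ m) + ((n - m : ℝ) / 2 + E) * (B * φ m) := by ring
        _ ≤ _ := by gcongr
    have hRl : R * (1 + l) = 6 * E + 6 * (E * l) + 4 * (B * K * (1 + l)) + 4 + 4 * l := by
      rw [hR]; ring
    have hEl : 0 ≤ E * l := mul_nonneg hE0 hl
    linarith
  have hsum := hS a ha0 hpair
  have hS' : 0 ≤ Real.exp (σ * (C₁ + D)) * S := by positivity
  refine ⟨fun n => by linarith [hupper n], ?_⟩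
  calc ∑' n : ℕ, ENNReal.ofReal (Real.exp (σ * (h n ^ β - n)))
      = ∑' n : ℕ, ENNReal.ofReal (Real.exp (σ * (C₁ + J + D))) *
          ENNReal.ofReal (Real.exp (-σ * a n)) := by
        refine tsum_congr fun n => ?_
        rw [← ENNReal.ofReal_mul (Real.exp_pos _).le, ← Real.exp_add]
        congr 2
        simp only [ha]
        ring
    _ = ENNReal.ofReal (Real.exp (σ * (C₁ + J + D))) *
          ∑' n : ℕ, ENNReal.ofReal (Real.exp (-σ * a n)) := ENNReal.tsum_mul_left
    _ ≤ ENNReal.ofReal (Real.exp (σ * (C₁ + J + D))) * ENNReal.ofReal S := by gcongr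
    _ = ENNReal.ofReal (Real.exp (σ * (C₁ + D)) * S * Real.exp (σ * J)) := by
        rw [← ENNReal.ofReal_mul (Real.exp_pos _).le,
          show σ * (C₁ + J + D) = σ * (C₁ + D) + σ * J by ring, Real.exp_add]
        congr 1
        ring
    _ ≤ _ := by
        refine ENNReal.ofReal_le_ofReal ?_
        gcongr
        linarith

end Sequence

/-! ### The pointwise estimate off the exceptional sets. -/

/-- Bounds on the rearrangement `κ` of a kernel: the power bound near zero, and the logarithmic
growth of its `β`-energy. -/
structure IsAdamsProfile (β H C : ℝ) (κ : ℝ → ℝ≥0∞) : Prop where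
  measurable : Measurable κ
  le_rpow : ∀ t : ℝ, 0 < t → t ≤ 1 → κ t ≤ ENNReal.ofReal ((1 + H) * t ^ (-(1 / β)))
  lintegral_le : ∀ m n : ℕ, m ≤ n →
    ∫⁻ t in Ioc (Real.exp (-(n : ℝ))) (Real.exp (-(m : ℝ))), κ t ^ β ≤ ENNReal.ofReal (n - m + C)

section Weighted

variable {X : Type*} [MeasurableSpace X] {μ : Measure X}

theorem lintegral_mul_le_weighted {β p : ℝ} (hp : β.HolderConjugate p) {w u f : X → ℝ≥0∞}
    (hw : Measurable w) (hu : Measurable u) (hf : Measurable f) :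
    ∫⁻ x, w x * (u x * f x) ∂μ ≤
      (∫⁻ x, w x * u x ^ β ∂μ) ^ (1 / β) * (∫⁻ x, w x * f x ^ p ∂μ) ^ (1 / p) := by
  have h := ENNReal.lintegral_mul_le_Lp_mul_Lq (μ.withDensity w) hp hu.aemeasurable hf.aemeasurable
  rw [lintegral_withDensity_eq_lintegral_mul _ hw (hu.mul hf),
    lintegral_withDensity_eq_lintegral_mul _ hw (hu.pow_const β),
    lintegral_withDensity_eq_lintegral_mul _ hw (hf.pow_const p)] at h
  exact h

theorem lintegral_eq_weighted_add {w v : X → ℝ≥0∞} (hw : Measurable w) (hw1 : ∀ x, w x ≤ 1)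
    (hv : Measurable v) :
    ∫⁻ x, v x ∂μ = ∫⁻ x, w x * v x ∂μ + ∫⁻ x, (1 - w x) * v x ∂μ := by
  have hwv : Measurable fun x => w x * v x := hw.mul hv
  rw [← lintegral_add_left hwv]
  refine lintegral_congr fun x => ?_
  rw [← add_mul, add_tsub_cancel_of_le (hw1 x), one_mul]

end Weighted

theorem conj_sub_inv {β p : ℝ} (hp : β.HolderConjugate p) : 1 - 1 / β = 1 / p := by
  have := hp.inv_add_inv_eq_one
  simp only [one_div]
  linarith

section Pointwise

variable {X : Type*} [MeasurableSpace X] {μ : Measure X} {g f : X → ℝ≥0∞}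
  {κ : ℝ → ℝ≥0∞} {β p H C : ℝ}

/-- The weight selecting the largest values of `f` up to mass `e^{-n}`. -/
noncomputable abbrev dyadicWeight (μ : Measure X) (f : X → ℝ≥0∞) (n : ℕ) : X → ℝ≥0∞ :=
  topWeight μ f (ENNReal.ofReal (Real.exp (-(n : ℝ))))

/-- The `p`-energy of the largest values of `f` up to mass `e^{-n}`. -/
noncomputable def topEnergy (μ : Measure X) (f : X → ℝ≥0∞) (p : ℝ) (n : ℕ) : ℝ≥0∞ :=
  ∫⁻ x, dyadicWeight μ f n x * f x ^ p ∂μ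

theorem topEnergy_antitone (μ : Measure X) (f : X → ℝ≥0∞) (p : ℝ) : Antitone (topEnergy μ f p) := by
  intro m n hmn
  refine lintegral_mono fun x => mul_le_mul_left (topWeight_mono ?_ x) _
  refine ENNReal.ofReal_le_ofReal (Real.exp_le_exp.2 ?_)
  have : (m : ℝ) ≤ n := by exact_mod_cast hmn
  linarith

theorem topEnergy_le (μ : Measure X) (f : X → ℝ≥0∞) (p : ℝ) (n : ℕ) :
    topEnergy μ f p n ≤ ∫⁻ x, f x ^ p ∂μ :=
  lintegral_mono fun x => mul_le_of_le_one_left' (topWeight_le_one _ x)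

theorem lintegral_partAbove_kernelLevel_rpow_le [SFinite μ] (hκ : IsAdamsProfile β H C κ)
    (hβ : 0 < β) (hH : 0 ≤ H) (hg : Measurable g)
    (hdom : ∀ t : ℝ, 0 < t → μ {x | κ t < g x} ≤ ENNReal.ofReal t) {a : ℝ} (ha : 0 < a)
    (haβ : a < β) (n : ℕ) :
    ∫⁻ x, partAbove (kernelLevel β H n) (g x) ^ a ∂μ ≤
      ENNReal.ofReal ((1 + H) ^ a * Real.exp (-(n : ℝ)) ^ (1 - a / β) / (1 - a / β)) := by
  refine lintegral_partAbove_rpow_le hg hβ ha haβ (by linarith) (Real.exp_pos _) ?_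
  intro t ht htT
  have ht1 : t ≤ 1 := htT.trans (Real.exp_le_one_iff.2 (by simp))
  exact (measure_mono fun x hx => (hκ.le_rpow t ht ht1).trans_lt hx).trans (hdom t ht)

/-- The measure w_m dμ has mass at most e^{-m}, so it sees the profile only on (0, e^{-m}], where
the capped energy is n - m + O(1). -/
theorem lintegral_dyadicWeight_mul_min_le [SFinite μ] (hp : β.HolderConjugate p)
    (hκ : IsAdamsProfile β H C κ) (hH : 0 ≤ H) (hC : 0 ≤ C) (hg : Measurable g)
    (hdom : ∀ t : ℝ, 0 < t → μ {x | κ t < g x} ≤ ENNReal.ofReal t) (hf : Measurable f)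
    {m n : ℕ} (hmn : m ≤ n) :
    ∫⁻ x, dyadicWeight μ f m x * (min (g x) (kernelLevel β H n) * f x) ∂μ ≤
      ENNReal.ofReal (n - m + (C + (1 + H) ^ β)) ^ (1 / β) * topEnergy μ f p m ^ (1 / p) := by
  have hβ := hp.pos
  have hw := measurable_topWeight (μ := μ) hf (ENNReal.ofReal (Real.exp (-(m : ℝ))))
  refine (lintegral_mul_le_weighted hp hw (hg.min measurable_const) hf).trans ?_
  refine mul_le_mul_left (ENNReal.rpow_le_rpow ?_ (by positivity)) _
  have h1 := lintegral_withDensity_eq_lintegral_mul μ hw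
    (((hg.min measurable_const).pow_const β : Measurable fun x =>
      min (g x) (kernelLevel β H n) ^ β))
  refine (le_of_eq h1.symm).trans ?_
  refine lintegral_min_kernelLevel_le_of_mass_le (μ := μ) ?_ hg hκ.measurable hdom hβ hH hC hmn ?_
    (hκ.lintegral_le m n hmn)
  · calc μ.withDensity (dyadicWeight μ f m) ≤ μ.withDensity 1 :=
          withDensity_mono (.of_forall fun x => topWeight_le_one _ x)
      _ = μ := withDensity_one
  · rw [withDensity_apply _ MeasurableSet.univ, Measure.restrict_univ]
    exact lintegral_topWeight_le hf _

theorem lintegral_one_sub_dyadicWeight_mul_min_le [SFinite μ] (hp : β.HolderConjugate p)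
    (hκ : IsAdamsProfile β H C κ) (hH : 0 ≤ H) (hC : 0 ≤ C) (hg : Measurable g)
    (hdom : ∀ t : ℝ, 0 < t → μ {x | κ t < g x} ≤ ENNReal.ofReal t) (hf : Measurable f) (m : ℕ) :
    ∫⁻ x, (1 - dyadicWeight μ f m x) * (min (g x) (kernelLevel β H m) * f x) ∂μ ≤
      (ENNReal.ofReal (m + (C + (1 + H) ^ β)) + ∫⁻ t in Ioi 1, κ t ^ β) ^ (1 / β) *
        (∫⁻ x, (1 - dyadicWeight μ f m x) * f x ^ p ∂μ) ^ (1 / p) := by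
  have hβ := hp.pos
  have hw := measurable_topWeight (μ := μ) hf (ENNReal.ofReal (Real.exp (-(m : ℝ))))
  refine (lintegral_mul_le_weighted hp (measurable_const.sub hw) (hg.min measurable_const)
    hf).trans ?_
  refine mul_le_mul_left (ENNReal.rpow_le_rpow ?_ (by positivity)) _
  refine (lintegral_mono fun x => mul_le_of_le_one_left' tsub_le_self).trans ?_
  exact lintegral_min_kernelLevel_le hg hκ.measurable hdom hβ hH hC m
    (hκ.lintegral_le 0 m (Nat.zero_le m))

/-- Outside the selected part f is at most the level ρ, the high part of g has integral of order
e^{-m/p}, and ρ e^{-m/p} ≤ Φ_m^{1/p}. -/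
theorem lintegral_one_sub_dyadicWeight_mul_partAbove_le [SFinite μ] (hp : β.HolderConjugate p)
    (hκ : IsAdamsProfile β H C κ) (hH : 0 ≤ H) (hg : Measurable g)
    (hdom : ∀ t : ℝ, 0 < t → μ {x | κ t < g x} ≤ ENNReal.ofReal t) (hf : Measurable f)
    (hfp : ∫⁻ x, f x ^ p ∂μ ≠ ⊤) (m : ℕ) :
    ∫⁻ x, (1 - dyadicWeight μ f m x) * (partAbove (kernelLevel β H m) (g x) * f x) ∂μ ≤
      ENNReal.ofReal ((1 + H) * p) * topEnergy μ f p m ^ (1 / p) := by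
  have hβ := hp.pos
  have hp0 := hp.symm.pos
  set T := ENNReal.ofReal (Real.exp (-(m : ℝ))) with hT
  have hK := lintegral_partAbove_kernelLevel_rpow_le hκ hβ hH hg hdom one_pos hp.lt m
  simp only [ENNReal.rpow_one, Real.rpow_one] at hK
  rw [conj_sub_inv hp, div_div_eq_mul_div, div_one, mul_right_comm,
    ENNReal.ofReal_mul (by positivity), ← ENNReal.ofReal_rpow_of_pos (Real.exp_pos _), ← hT] at hK
  have hρ : upperLevel μ f T * T ^ (1 / p) ≤ topEnergy μ f p m ^ (1 / p) := by
    have := ENNReal.rpow_le_rpow (upperLevel_rpow_mul_le hp0 hf hfp T)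
      (show 0 ≤ 1 / p by positivity)
    rwa [ENNReal.mul_rpow_of_nonneg _ _ (by positivity), ← ENNReal.rpow_mul,
      mul_one_div_cancel hp0.ne', ENNReal.rpow_one] at this
  calc _ ≤ ∫⁻ x, upperLevel μ f T * partAbove (kernelLevel β H m) (g x) ∂μ := by
        refine lintegral_mono fun x => ?_
        rw [mul_left_comm, mul_comm (upperLevel μ f T)]
        exact mul_le_mul_right (one_sub_topWeight_mul_le T x) _
    _ = upperLevel μ f T * ∫⁻ x, partAbove (kernelLevel β H m) (g x) ∂μ :=
        lintegral_const_mul _ ((measurable_partAbove _).comp hg)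
    _ ≤ upperLevel μ f T * (ENNReal.ofReal ((1 + H) * p) * T ^ (1 / p)) := by gcongr
    _ = ENNReal.ofReal ((1 + H) * p) * (upperLevel μ f T * T ^ (1 / p)) := by ring
    _ ≤ _ := by gcongr

/-- Split g at level n. The capped part is split by w_m, and its unselected piece once more at level
m; the high part is split by w_n. In the constant 1 + 2(1 + H)p, the 1 is the singular piece and the
other two terms are the unselected high pieces at levels m and n. -/
theorem lintegral_mul_le_pointwise [SFinite μ] (hp : β.HolderConjugate p)
    (hκ : IsAdamsProfile β H C κ) (hH : 0 ≤ H) (hC : 0 ≤ C) (hg : Measurable g)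
    (hdom : ∀ t : ℝ, 0 < t → μ {x | κ t < g x} ≤ ENNReal.ofReal t) (hf : Measurable f)
    (hfp : ∫⁻ x, f x ^ p ∂μ ≤ 1) {m n : ℕ} (hmn : m ≤ n) (hJ : ∫⁻ t in Ioi 1, κ t ^ β ≠ ⊤)
    (hexc : ∫⁻ x, dyadicWeight μ f n x * (partAbove (kernelLevel β H n) (g x) * f x) ∂μ ≤
      topEnergy μ f p n ^ (1 / p)) :
    ∫⁻ x, g x * f x ∂μ ≤ ENNReal.ofReal (
      (m + ((C + (1 + H) ^ β) + (∫⁻ t in Ioi 1, κ t ^ β).toReal)) ^ (1 / β) *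
        (1 - (topEnergy μ f p m).toReal) ^ (1 / p) +
      ((n - m + (C + (1 + H) ^ β)) ^ (1 / β) + (1 + 2 * ((1 + H) * p))) *
        (topEnergy μ f p m).toReal ^ (1 / p)) := by
  have hβ := hp.pos
  have hp0 := hp.symm.pos
  have hmn' : (0 : ℝ) ≤ n - m := by
    have : (m : ℝ) ≤ n := by exact_mod_cast hmn
    linarith
  have hfp' : ∫⁻ x, f x ^ p ∂μ ≠ ⊤ := ne_top_of_le_ne_top ENNReal.one_ne_top hfp
  have hwm := measurable_topWeight (μ := μ) hf (ENNReal.ofReal (Real.exp (-(m : ℝ))))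
  have hwn := measurable_topWeight (μ := μ) hf (ENNReal.ofReal (Real.exp (-(n : ℝ))))
  have hKn : Measurable fun x => partAbove (kernelLevel β H n) (g x) * f x :=
    ((measurable_partAbove _).comp hg).mul hf
  have hmin : ∀ k, Measurable fun x => min (g x) (kernelLevel β H k) * f x := fun k =>
    (hg.min measurable_const).mul hf
  set J := ∫⁻ t in Ioi 1, κ t ^ β with hJd
  set C₁ := C + (1 + H) ^ β with hC₁
  have hC₁0 : 0 ≤ C₁ := by positivity
  set c := (1 + H) * p with hc
  have hc0 : 0 ≤ c := by positivity
  set Φ := topEnergy μ f p m with hΦ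
  have hΦn : topEnergy μ f p n ^ (1 / p) ≤ Φ ^ (1 / p) :=
    ENNReal.rpow_le_rpow (topEnergy_antitone μ f p hmn) (by positivity)
  have hΦ1 : Φ ≤ 1 := (topEnergy_le μ f p m).trans hfp
  have hΦtop : Φ ≠ ⊤ := ne_top_of_le_ne_top ENNReal.one_ne_top hΦ1
  have hrest : ∫⁻ x, (1 - dyadicWeight μ f m x) * f x ^ p ∂μ ≤ 1 - Φ := by
    refine ENNReal.le_sub_of_add_le_left hΦtop ?_
    rw [hΦ, topEnergy, ← lintegral_eq_weighted_add hwm (topWeight_le_one _) (hf.pow_const p)]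
    exact hfp
  have hsplit : ∫⁻ x, g x * f x ∂μ ≤
      ∫⁻ x, min (g x) (kernelLevel β H n) * f x ∂μ +
        ∫⁻ x, partAbove (kernelLevel β H n) (g x) * f x ∂μ := by
    rw [← lintegral_add_left (hmin n)]
    refine lintegral_mono fun x => ?_
    rw [← add_mul]
    exact mul_le_mul_left (le_min_add_partAbove _ _) _
  have hlow : ∫⁻ x, (1 - dyadicWeight μ f m x) * (min (g x) (kernelLevel β H n) * f x) ∂μ ≤
      ∫⁻ x, (1 - dyadicWeight μ f m x) * (min (g x) (kernelLevel β H m) * f x) ∂μ +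
      ∫⁻ x, (1 - dyadicWeight μ f m x) * (partAbove (kernelLevel β H m) (g x) * f x) ∂μ := by
    have hmeas : Measurable fun x => (1 - dyadicWeight μ f m x) *
        (min (g x) (kernelLevel β H m) * f x) := (measurable_const.sub hwm).mul (hmin m)
    rw [← lintegral_add_left hmeas]
    refine lintegral_mono fun x => ?_
    rw [← mul_add, ← add_mul]
    gcongr
    exact (min_le_left _ _).trans (le_min_add_partAbove _ _)
  have hJm : ENNReal.ofReal (m + C₁) + J = ENNReal.ofReal (m + (C₁ + J.toReal)) := by
    rw [← add_assoc (m : ℝ) C₁ J.toReal, ENNReal.ofReal_add (by positivity) ENNReal.toReal_nonneg,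
      ENNReal.ofReal_toReal hJ]
  have hΦr : Φ ^ (1 / p) = ENNReal.ofReal (Φ.toReal ^ (1 / p)) := by
    rw [← ENNReal.ofReal_rpow_of_nonneg ENNReal.toReal_nonneg (by positivity),
      ENNReal.ofReal_toReal hΦtop]
  have hΦr1 : Φ.toReal ≤ 1 := ENNReal.toReal_le_of_le_ofReal zero_le_one (by simpa using hΦ1)
  have h1Φ : (1 - Φ) ^ (1 / p) = ENNReal.ofReal ((1 - Φ.toReal) ^ (1 / p)) := by
    rw [← ENNReal.ofReal_rpow_of_nonneg (by linarith) (by positivity),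
      ENNReal.ofReal_sub _ ENNReal.toReal_nonneg, ENNReal.ofReal_one, ENNReal.ofReal_toReal hΦtop]
  have e1 := lintegral_dyadicWeight_mul_min_le hp hκ hH hC hg hdom hf hmn
  have e2 := lintegral_one_sub_dyadicWeight_mul_min_le hp hκ hH hC hg hdom hf m
  have e3 := lintegral_one_sub_dyadicWeight_mul_partAbove_le hp hκ hH hg hdom hf hfp' m
  have e4 := lintegral_one_sub_dyadicWeight_mul_partAbove_le hp hκ hH hg hdom hf hfp' n
  calc ∫⁻ x, g x * f x ∂μ
      ≤ (∫⁻ x, dyadicWeight μ f m x * (min (g x) (kernelLevel β H n) * f x) ∂μ +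
          (∫⁻ x, (1 - dyadicWeight μ f m x) * (min (g x) (kernelLevel β H m) * f x) ∂μ +
          ∫⁻ x, (1 - dyadicWeight μ f m x) * (partAbove (kernelLevel β H m) (g x) * f x) ∂μ)) +
        (∫⁻ x, dyadicWeight μ f n x * (partAbove (kernelLevel β H n) (g x) * f x) ∂μ +
          ∫⁻ x, (1 - dyadicWeight μ f n x) *
            (partAbove (kernelLevel β H n) (g x) * f x) ∂μ) := by
        rw [← lintegral_eq_weighted_add hwn (topWeight_le_one _) hKn]
        refine hsplit.trans (add_le_add ?_ le_rfl)
        rw [lintegral_eq_weighted_add hwm (topWeight_le_one _) (hmin n)]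
        exact add_le_add le_rfl hlow
    _ ≤ (ENNReal.ofReal (n - m + C₁) ^ (1 / β) * Φ ^ (1 / p) +
          ((ENNReal.ofReal (m + C₁) + J) ^ (1 / β) * (1 - Φ) ^ (1 / p) +
            ENNReal.ofReal c * Φ ^ (1 / p))) +
        (Φ ^ (1 / p) + ENNReal.ofReal c * Φ ^ (1 / p)) := by
        refine add_le_add (add_le_add e1 (add_le_add (e2.trans ?_) e3))
          (add_le_add (hexc.trans hΦn) (e4.trans ?_))
        · exact mul_le_mul_right (ENNReal.rpow_le_rpow hrest (by positivity)) _
        · exact mul_le_mul_right hΦn _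
    _ = _ := by
        have hJ0 : 0 ≤ J.toReal := ENNReal.toReal_nonneg
        have hΦ0 : 0 ≤ Φ.toReal := ENNReal.toReal_nonneg
        have hs : 0 ≤ (1 - Φ.toReal) ^ (1 / p) := Real.rpow_nonneg (by linarith) _
        rw [hJm, hΦr, h1Φ, ENNReal.ofReal_rpow_of_nonneg (by positivity) (by positivity),
          ENNReal.ofReal_rpow_of_nonneg (by positivity) (by positivity),
          ← ENNReal.ofReal_mul (by positivity), ← ENNReal.ofReal_mul (by positivity),
          ← ENNReal.ofReal_mul (by positivity), ← ENNReal.ofReal_add (by positivity) (by positivity),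
          ← ENNReal.ofReal_add (by positivity) (by positivity),
          ← ENNReal.ofReal_add (by positivity) (by positivity),
          ← ENNReal.ofReal_add (by positivity) (by positivity)]
        congr 1
        ring

end Pointwise

/-! ### The singular part and the measure of the exceptional sets. -/

/-- The power (1 - θ)β < β is integrable in y under the first rearrangement bound, and θp < σβ is
integrable in x under the second. Since (β - 1)p = β, the witness has θp = σ/2. -/
theorem exists_interpolation_exponent {β p σ : ℝ} (hp : β.HolderConjugate p) (hσ : 0 < σ)
    (hσ1 : σ ≤ 1) : ∃ θ : ℝ, 0 < θ ∧ θ < 1 ∧ θ * p < σ * β := by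
  have hβ := hp.lt
  have hp0 := hp.symm.pos
  have h : (β - 1) * p = β := hp.sub_one_mul_conj
  refine ⟨σ * (β - 1) / (2 * β), ?_, ?_, ?_⟩
  · have : 0 < β - 1 := by linarith
    positivity
  · rw [div_lt_one (by linarith)]
    nlinarith
  · have : σ * (β - 1) / (2 * β) * p = σ / 2 := by
      rw [div_mul_eq_mul_div, mul_assoc, h]
      field_simp
    rw [this]
    nlinarith

theorem lintegral_mul_partAbove_rpow_le {X : Type*} [MeasurableSpace X] {μ : Measure X}
    {β p θ : ℝ} (hp : β.HolderConjugate p) (hθ : 0 < θ) (hθ1 : θ < 1) {w K f : X → ℝ≥0∞}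
    (hw : Measurable w) (hw1 : ∀ x, w x ≤ 1) (hK : Measurable K) (hf : Measurable f) :
    (∫⁻ x, w x * (K x * f x) ∂μ) ^ p ≤
      (∫⁻ x, K x ^ ((1 - θ) * β) ∂μ) ^ (p / β) * ∫⁻ x, w x * (K x ^ (θ * p) * f x ^ p) ∂μ := by
  have hβ := hp.pos
  have hp0 := hp.symm.pos
  have h := lintegral_mul_le_weighted (μ := μ) hp hw (hK.pow_const (1 - θ))
    ((hK.pow_const θ).mul hf)
  have e1 : ∀ x, w x * (K x ^ (1 - θ) * (K x ^ θ * f x)) = w x * (K x * f x) := fun x => by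
    rw [← mul_assoc (K x ^ (1 - θ)), ← ENNReal.rpow_add_of_nonneg _ _ (by linarith) hθ.le,
      sub_add_cancel, ENNReal.rpow_one]
  have e2 : ∀ x, w x * (K x ^ θ * f x) ^ p = w x * (K x ^ (θ * p) * f x ^ p) := fun x => by
    rw [ENNReal.mul_rpow_of_nonneg _ _ hp0.le, ← ENNReal.rpow_mul]
  simp only [Pi.mul_apply, e1, e2, ← ENNReal.rpow_mul] at h
  have h2 := ENNReal.rpow_le_rpow h hp0.le
  rw [ENNReal.mul_rpow_of_nonneg _ _ hp0.le, ← ENNReal.rpow_mul, ← ENNReal.rpow_mul,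
    one_div_mul_cancel hp0.ne', ENNReal.rpow_one, one_div_mul_eq_div] at h2
  refine h2.trans (mul_le_mul_left (ENNReal.rpow_le_rpow ?_ (by positivity)) _)
  exact lintegral_mono fun x => mul_le_of_le_one_left' (hw1 x)

section Product

variable {M : Type u} {N : Type v} [MeasurableSpace M] [MeasurableSpace N]
  {μ : Measure M} {ν : Measure N} [SFinite μ] {g : N → M → ℝ≥0∞} {f : M → ℝ≥0∞}
  {β p σ H B : ℝ}

/-- The part of the operator coming from large kernel values and large values of `f`. -/
noncomputable def singularPart (μ : Measure M) (β H : ℝ) (g : N → M → ℝ≥0∞) (f : M → ℝ≥0∞)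
    (n : ℕ) (x : N) : ℝ≥0∞ :=
  ∫⁻ y, dyadicWeight μ f n y * (partAbove (kernelLevel β H n) (g x y) * f y) ∂μ

theorem measurable_singularPart (hg : Measurable (Function.uncurry g)) (hf : Measurable f)
    (n : ℕ) : Measurable (singularPart μ β H g f n) := by
  refine Measurable.lintegral_prod_right' (f := fun z : N × M => dyadicWeight μ f n z.2 *
    (partAbove (kernelLevel β H n) (g z.1 z.2) * f z.2)) ?_
  exact ((measurable_topWeight hf _).comp measurable_snd).mul
    (((measurable_partAbove _).comp hg).mul (hf.comp measurable_snd))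

theorem exists_lintegral_singularPart_rpow_le (hp : β.HolderConjugate p) (hσ : 0 < σ)
    (hσ1 : σ ≤ 1) (hH : 0 ≤ H) (hB : 0 < B) :
    ∃ D : ℝ, 0 < D ∧ ∀ (M : Type u) (N : Type v) [MeasurableSpace M] [MeasurableSpace N]
      (μ : Measure M) (ν : Measure N) [SFinite μ] [SFinite ν] (C : ℝ) (κ : ℝ → ℝ≥0∞)
      (g : N → M → ℝ≥0∞) (f : M → ℝ≥0∞), IsAdamsProfile β H C κ →
      Measurable (Function.uncurry g) → Measurable f →
      (∀ᵐ x ∂ν, ∀ t : ℝ, 0 < t → μ {y | κ t < g x y} ≤ ENNReal.ofReal t) →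
      (∀ᵐ y ∂μ, ∀ t : ℝ, 0 < t →
        ν {x | ENNReal.ofReal (B * t ^ (-(1 / (σ * β)))) < g x y} ≤ ENNReal.ofReal t) →
      ∀ n : ℕ, ∫⁻ x, singularPart μ β H g f n x ^ p ∂ν ≤
        ENNReal.ofReal (D * Real.exp (-σ * n)) * topEnergy μ f p n := by
  have hβ := hp.pos
  have hp0 := hp.symm.pos
  obtain ⟨θ, hθ, hθ1, hθp⟩ := exists_interpolation_exponent hp hσ hσ1
  have hσβ : 0 < σ * β := by positivity
  have hb1 : 0 < 1 - θ * p / (σ * β) := by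
    rw [sub_pos, div_lt_one hσβ]; exact hθp
  set D₁ := (((1 + H) ^ ((1 - θ) * β)) / θ) ^ (p / β) with hD₁
  have hD₁0 : 0 < D₁ := by positivity
  -- Chosen so that the second bound at mass T₀ e^{-σn} equals the kernel level n.
  set T₀ := (B / (1 + H)) ^ (σ * β) with hT₀
  have hT₀0 : 0 < T₀ := by positivity
  set D₂ := B ^ (θ * p) * T₀ ^ (1 - θ * p / (σ * β)) / (1 - θ * p / (σ * β)) with hD₂
  have hD₂0 : 0 < D₂ := by positivity
  refine ⟨D₁ * D₂, by positivity, ?_⟩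
  intro M N _ _ μ ν _ _ C κ g f hκ hg hf hx hy n
  set E := Real.exp (-(n : ℝ)) with hE
  have hE0 : 0 < E := Real.exp_pos _
  set s := kernelLevel β H n with hs
  have hKm : Measurable fun z : N × M => partAbove s (g z.1 z.2) := (measurable_partAbove _).comp hg
  have hw := measurable_topWeight (μ := μ) hf (ENNReal.ofReal (Real.exp (-(n : ℝ))))
  have h1 : ∀ᵐ x ∂ν, singularPart μ β H g f n x ^ p ≤ ENNReal.ofReal (D₁ * E ^ (θ * p / β)) *
      ∫⁻ y, dyadicWeight μ f n y * (partAbove s (g x y) ^ (θ * p) * f y ^ p) ∂μ := by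
    filter_upwards [hx] with x hx
    have hgx : Measurable (g x) := hg.of_uncurry_left
    refine (lintegral_mul_partAbove_rpow_le hp hθ hθ1 hw (topWeight_le_one _)
      ((measurable_partAbove s).comp hgx) hf).trans ?_
    refine mul_le_mul_left ?_ _
    have h := lintegral_partAbove_kernelLevel_rpow_le hκ hβ hH hgx hx
      (a := (1 - θ) * β) (mul_pos (by linarith) hβ) (by nlinarith) n
    rw [mul_div_cancel_right₀ _ hβ.ne', sub_sub_cancel] at h
    refine (ENNReal.rpow_le_rpow h (by positivity)).trans (le_of_eq ?_)
    rw [ENNReal.ofReal_rpow_of_nonneg (by positivity) (by positivity)]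
    congr 1
    rw [mul_div_right_comm, Real.mul_rpow (by positivity) (by positivity), ← Real.rpow_mul hE0.le,
      mul_div_assoc]
  have h2 : ∀ᵐ y ∂μ, ∫⁻ x, partAbove s (g x y) ^ (θ * p) ∂ν ≤
      ENNReal.ofReal (D₂ * E ^ (σ * (1 - θ * p / (σ * β)))) := by
    filter_upwards [hy] with y hy
    have hgy : Measurable fun x => g x y := hg.of_uncurry_right
    have hT : 0 < T₀ * E ^ σ := by positivity
    have h := lintegral_partAbove_rpow_le (μ := ν) hgy hσβ (a := θ * p) (by positivity) hθp hB hT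
      (fun t ht _ => hy t ht)
    have hlev : ENNReal.ofReal (B * (T₀ * E ^ σ) ^ (-(1 / (σ * β)))) = s := by
      rw [hs, kernelLevel, ← hE, Real.mul_rpow hT₀0.le (by positivity), hT₀,
        ← Real.rpow_mul (by positivity), ← Real.rpow_mul hE0.le,
        show σ * β * -(1 / (σ * β)) = -1 by field_simp,
        show σ * -(1 / (σ * β)) = -(1 / β) by field_simp, Real.rpow_neg_one, inv_div, ← mul_assoc,
        mul_div_cancel₀ _ hB.ne']
    rw [hlev] at h
    refine h.trans (le_of_eq ?_)
    congr 1
    rw [Real.mul_rpow hT₀0.le (by positivity), ← Real.rpow_mul hE0.le, hD₂]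
    ring
  calc ∫⁻ x, singularPart μ β H g f n x ^ p ∂ν
      ≤ ∫⁻ x, ENNReal.ofReal (D₁ * E ^ (θ * p / β)) *
          ∫⁻ y, dyadicWeight μ f n y * (partAbove s (g x y) ^ (θ * p) * f y ^ p) ∂μ ∂ν :=
        lintegral_mono_ae h1
    _ = ENNReal.ofReal (D₁ * E ^ (θ * p / β)) *
          ∫⁻ x, ∫⁻ y, dyadicWeight μ f n y * (partAbove s (g x y) ^ (θ * p) * f y ^ p) ∂μ ∂ν := by
        rw [lintegral_const_mul' _ _ ENNReal.ofReal_ne_top]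
    _ = ENNReal.ofReal (D₁ * E ^ (θ * p / β)) *
          ∫⁻ y, ∫⁻ x, dyadicWeight μ f n y * (partAbove s (g x y) ^ (θ * p) * f y ^ p) ∂ν ∂μ := by
        rw [lintegral_lintegral_swap]
        exact ((hw.comp measurable_snd).mul ((hKm.pow_const _).mul
          ((hf.pow_const p).comp measurable_snd))).aemeasurable
    _ ≤ ENNReal.ofReal (D₁ * E ^ (θ * p / β)) *
          ∫⁻ y, ENNReal.ofReal (D₂ * E ^ (σ * (1 - θ * p / (σ * β)))) *
            (dyadicWeight μ f n y * f y ^ p) ∂μ := by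
        refine mul_le_mul_right (lintegral_mono_ae ?_) _
        filter_upwards [h2] with y hy
        have hmy : Measurable fun x => partAbove s (g x y) ^ (θ * p) :=
          ((measurable_partAbove s).comp (hg.of_uncurry_right)).pow_const _
        calc ∫⁻ x, dyadicWeight μ f n y * (partAbove s (g x y) ^ (θ * p) * f y ^ p) ∂ν
            = ∫⁻ x, partAbove s (g x y) ^ (θ * p) * (dyadicWeight μ f n y * f y ^ p) ∂ν :=
              lintegral_congr fun x => by ring
          _ = (∫⁻ x, partAbove s (g x y) ^ (θ * p) ∂ν) * (dyadicWeight μ f n y * f y ^ p) :=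
              lintegral_mul_const _ hmy
          _ ≤ _ := by gcongr
    _ = ENNReal.ofReal (D₁ * E ^ (θ * p / β)) *
          (ENNReal.ofReal (D₂ * E ^ (σ * (1 - θ * p / (σ * β)))) * topEnergy μ f p n) := by
        rw [lintegral_const_mul' _ _ ENNReal.ofReal_ne_top, topEnergy]
    _ = _ := by
        rw [← mul_assoc, ← ENNReal.ofReal_mul (by positivity)]
        congr 2
        -- The dependence on θ cancels: the exponents add up to exactly σ.
        have : E ^ (θ * p / β) * E ^ (σ * (1 - θ * p / (σ * β))) = Real.exp (-σ * n) := by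
          rw [← Real.rpow_add hE0, hE, ← Real.exp_mul]
          congr 1
          field_simp
          ring
        rw [← this]
        ring

/-- Chebyshev at threshold Φ_n^{1/p}, where the factor Φ_n cancels. If Φ_n = 0 the singular part
vanishes almost everywhere. -/
theorem measure_lt_singularPart_le (hp0 : 0 < p) {D : ℝ} {n : ℕ}
    (hg : Measurable (Function.uncurry g)) (hf : Measurable f) (hfp : ∫⁻ y, f y ^ p ∂μ ≠ ⊤)
    (h : ∫⁻ x, singularPart μ β H g f n x ^ p ∂ν ≤
        ENNReal.ofReal D * topEnergy μ f p n) :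
    ν {x | topEnergy μ f p n ^ (1 / p) < singularPart μ β H g f n x} ≤ ENNReal.ofReal D := by
  have hm : Measurable fun x => singularPart μ β H g f n x ^ p :=
    (measurable_singularPart hg hf n).pow_const p
  set Φ := topEnergy μ f p n with hΦ
  have hΦtop : Φ ≠ ⊤ := ne_top_of_le_ne_top hfp (topEnergy_le μ f p n)
  have hsub : ∀ x, Φ ^ (1 / p) < singularPart μ β H g f n x →
      Φ < singularPart μ β H g f n x ^ p := fun x hx => by
    have := ENNReal.rpow_lt_rpow hx hp0
    rwa [← ENNReal.rpow_mul, one_div_mul_cancel hp0.ne', ENNReal.rpow_one] at this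
  rcases eq_or_ne Φ 0 with h0 | h0
  · rw [h0, mul_zero, nonpos_iff_eq_zero, lintegral_eq_zero_iff hm] at h
    have : ν {x | Φ ^ (1 / p) < singularPart μ β H g f n x} = 0 := by
      refine measure_mono_null (fun x hx => ?_) (ae_iff.1 h)
      have h3 := hsub x hx
      rw [h0] at h3
      exact h3.ne'
    rw [this]
    exact zero_le
  · have hM := mul_meas_ge_le_lintegral (μ := ν) hm Φ
    have h3 := hM.trans h
    rw [mul_comm (ENNReal.ofReal D), ENNReal.mul_le_mul_iff_right h0 hΦtop] at h3
    exact (measure_mono fun x hx => (hsub x hx).le).trans h3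

end Product

/-! ### Summation over the layers. -/

theorem IsAdamsProfile.of_le {β γ H C : ℝ} (hγ : 0 ≤ γ) (hH : 0 ≤ H) {κ : ℝ → ℝ≥0∞}
    (hanti : Antitone κ) (h : ∀ t : ℝ, 0 < t → t ≤ 1 →
      κ t ≤ ENNReal.ofReal (t ^ (-(1 / β)) * (1 + H * (1 + |Real.log t|) ^ (-γ))))
    (hC : ∀ m n : ℕ, m ≤ n →
      ∫⁻ t in Ioc (Real.exp (-(n : ℝ))) (Real.exp (-(m : ℝ))), κ t ^ β ≤
        ENNReal.ofReal (n - m + C)) : IsAdamsProfile β H C κ where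
  measurable := hanti.measurable
  le_rpow t ht ht1 := by
    refine (h t ht ht1).trans (ENNReal.ofReal_le_ofReal ?_)
    rw [mul_comm]
    have h1 : (1 + |Real.log t|) ^ (-γ) ≤ 1 :=
      Real.rpow_le_one_of_one_le_of_nonpos (by linarith [abs_nonneg (Real.log t)]) (by linarith)
    have h2 : 0 ≤ t ^ (-(1 / β)) := Real.rpow_nonneg ht.le _
    gcongr
    nlinarith
  lintegral_le := hC

/-- If `F ≤ h n` off `E n` for all `n`, then `exp (σ F^β)` can be integrated layer by layer over the
sets `E n`. -/
theorem setLIntegral_exp_rpow_le {N : Type*} [MeasurableSpace N] {ν : Measure N} {σ β : ℝ}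
    (hσ : 0 ≤ σ) (hβ : 0 ≤ β) {F : N → ℝ≥0∞} {E : ℕ → Set N} (hE : ∀ n, MeasurableSet (E n))
    {h : ℕ → ℝ} (hh : ∀ n, 0 ≤ h n)
    (hF : ∀ᵐ x ∂ν, ∀ n, x ∉ E n → F x ≤ ENNReal.ofReal (h n)) (hnull : ν (⋂ n, E n) = 0)
    (S : Set N) :
    ∫⁻ x in S, ENNReal.ofReal (Real.exp (σ * (F x).toReal ^ β)) ∂ν ≤
      ENNReal.ofReal (Real.exp (σ * h 0 ^ β)) * ν S +
        ∑' n, ENNReal.ofReal (Real.exp (σ * h (n + 1) ^ β)) * ν (E n) := by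
  have hnull' : ∀ᵐ x ∂ν, x ∉ ⋂ n, E n := measure_eq_zero_iff_ae_notMem.1 hnull
  have hpt : ∀ᵐ x ∂ν, ENNReal.ofReal (Real.exp (σ * (F x).toReal ^ β)) ≤
      ENNReal.ofReal (Real.exp (σ * h 0 ^ β)) +
        ∑' n, (E n).indicator (fun _ => ENNReal.ofReal (Real.exp (σ * h (n + 1) ^ β))) x := by
    filter_upwards [hF, hnull'] with x hx hx'
    have hstep : ∀ n, x ∉ E n → ENNReal.ofReal (Real.exp (σ * (F x).toReal ^ β)) ≤
        ENNReal.ofReal (Real.exp (σ * h n ^ β)) := fun n hn => by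
      have := ENNReal.toReal_le_of_le_ofReal (hh n) (hx n hn)
      gcongr
    classical
    have hex : ∃ n, x ∉ E n := by simpa using hx'
    -- At the first n with x ∉ E n, either n = 0 or x lies in E (n - 1), whose term in the series
    -- carries h n.
    rcases Nat.eq_zero_or_pos (Nat.find hex) with h0 | h0
    · have := Nat.find_spec hex
      rw [h0] at this
      exact (hstep 0 this).trans le_self_add
    · obtain ⟨k, hk⟩ := Nat.exists_eq_succ_of_ne_zero h0.ne'
      have h1 := Nat.find_spec hex
      rw [hk] at h1
      have h2 : x ∈ E k := by
        by_contra hc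
        exact Nat.find_min hex (hk ▸ Nat.lt_succ_self k) hc
      refine (hstep _ h1).trans (le_add_left ?_)
      refine le_trans ?_ (ENNReal.le_tsum k)
      rw [indicator_of_mem h2]
  have hm : ∀ n, Measurable
      ((E n).indicator (fun _ => ENNReal.ofReal (Real.exp (σ * h (n + 1) ^ β)))) :=
    fun n => measurable_const.indicator (hE n)
  calc _ ≤ ∫⁻ x in S, (ENNReal.ofReal (Real.exp (σ * h 0 ^ β)) +
        ∑' n, (E n).indicator (fun _ => ENNReal.ofReal (Real.exp (σ * h (n + 1) ^ β))) x) ∂ν :=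
        lintegral_mono_ae (ae_restrict_of_ae hpt)
    _ = ENNReal.ofReal (Real.exp (σ * h 0 ^ β)) * ν S +
        ∑' n, ENNReal.ofReal (Real.exp (σ * h (n + 1) ^ β)) * ν.restrict S (E n) := by
        rw [lintegral_add_left measurable_const, setLIntegral_const,
          lintegral_tsum fun n => (hm n).aemeasurable]
        congr 2
        ext n
        rw [lintegral_indicator_const (hE n)]
    _ ≤ _ := by
        gcongr with n
        exact Measure.restrict_le_self

theorem exists_setLIntegral_exp_le {β p σ γ H B : ℝ} (hp : β.HolderConjugate p) (hσ : 0 < σ)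
    (hσ1 : σ ≤ 1) (hγ : 1 < γ) (hH : 0 ≤ H) (hB : 0 < B) :
    ∃ C : ℝ, 0 < C ∧ ∀ (M : Type u) (N : Type v) [MeasurableSpace M] [MeasurableSpace N]
      (μ : Measure M) (ν : Measure N) [SFinite μ] [SFinite ν] (κ : ℝ → ℝ≥0∞)
      (g : N → M → ℝ≥0∞), Antitone κ → (∀ t : ℝ, 0 < t → t ≤ 1 →
        κ t ≤ ENNReal.ofReal (t ^ (-(1 / β)) * (1 + H * (1 + |Real.log t|) ^ (-γ)))) →
      ∫⁻ t in Ioi 1, κ t ^ β ≠ ⊤ → Measurable (Function.uncurry g) →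
      (∀ᵐ x ∂ν, ∀ t : ℝ, 0 < t → μ {y | κ t < g x y} ≤ ENNReal.ofReal t) →
      (∀ᵐ y ∂μ, ∀ t : ℝ, 0 < t →
        ν {x | ENNReal.ofReal (B * t ^ (-(1 / (σ * β)))) < g x y} ≤ ENNReal.ofReal t) →
      ∀ f : M → ℝ≥0∞, Measurable f → ∫⁻ y, f y ^ p ∂μ ≤ 1 →
        (∀ᵐ x ∂ν, ∫⁻ y, g x y * f y ∂μ ≠ ⊤) ∧
        ∀ S : Set N,
          ∫⁻ x in S, ENNReal.ofReal (Real.exp (σ * (∫⁻ y, g x y * f y ∂μ).toReal ^ β)) ∂ν ≤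
            ENNReal.ofReal (C * Real.exp (σ * (∫⁻ t in Ioi 1, κ t ^ β).toReal)) * (1 + ν S) := by
  have hβ := hp.pos
  have hp0 := hp.symm.pos
  obtain ⟨C₀, hC₀, hmid⟩ := exists_lintegral_Ioc_exp_le hβ hγ hH
  obtain ⟨D, hD0, hD⟩ := exists_lintegral_singularPart_rpow_le.{u, v} hp hσ hσ1 hH hB
  obtain ⟨L, hL0, hL⟩ := exists_tsum_exp_rpow_sub_le hp hσ (C₁ := C₀ + (1 + H) ^ β)
    (C₂ := 1 + 2 * ((1 + H) * p)) (by positivity) (by positivity)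
  refine ⟨Real.exp (σ * L) + D * Real.exp σ * L, by positivity, ?_⟩
  intro M N _ _ μ ν _ _ κ g hanti hκ1 hJ hg hx hy f hf hfp
  have hκ : IsAdamsProfile β H C₀ κ :=
    IsAdamsProfile.of_le (by linarith) hH hanti hκ1 (hmid κ hκ1)
  have hfp' : ∫⁻ y, f y ^ p ∂μ ≠ ⊤ := ne_top_of_le_ne_top ENNReal.one_ne_top hfp
  set J := (∫⁻ t in Ioi 1, κ t ^ β).toReal with hJd
  have hJ0 : 0 ≤ J := ENNReal.toReal_nonneg
  set φ : ℕ → ℝ := fun n => (topEnergy μ f p n).toReal with hφ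
  have hφ0 : ∀ n, 0 ≤ φ n := fun n => ENNReal.toReal_nonneg
  have hφ1 : ∀ n, φ n ≤ 1 := fun n =>
    ENNReal.toReal_le_of_le_ofReal zero_le_one (by simpa using (topEnergy_le μ f p n).trans hfp)
  set b : ℕ → ℕ → ℝ := fun n m => (m + ((C₀ + (1 + H) ^ β) + J)) ^ (1 / β) *
        (1 - φ m) ^ (1 / p) +
      ((n - m + (C₀ + (1 + H) ^ β)) ^ (1 / β) + (1 + 2 * ((1 + H) * p))) * φ m ^ (1 / p) with hb
  have hb0 : ∀ n m, m ≤ n → 0 ≤ b n m := by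
    intro n m hmn
    have h1 : (0 : ℝ) ≤ n - m := by
      have : (m : ℝ) ≤ n := by exact_mod_cast hmn
      linarith
    have h2 := hφ0 m
    have h3 : 0 ≤ 1 - φ m := by linarith [hφ1 m]
    simp only [hb]
    positivity
  -- Off E n the bound holds for every m ≤ n, so the best one may be taken; it does not depend on x.
  set h : ℕ → ℝ := fun n => (Finset.range (n + 1)).inf' ⟨0, by simp⟩ (b n) with hh
  have hmem : ∀ n, ∃ m, m ≤ n ∧ h n = b n m := by
    intro n
    obtain ⟨m, hm, hmeq⟩ := Finset.exists_mem_eq_inf' (s := Finset.range (n + 1)) ⟨0, by simp⟩ (b n)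
    exact ⟨m, Nat.lt_succ_iff.1 (Finset.mem_range.1 hm), hmeq⟩
  have hh0 : ∀ n, 0 ≤ h n := by
    intro n
    obtain ⟨m, hm, hmeq⟩ := hmem n
    rw [hmeq]
    exact hb0 n m hm
  have hle : ∀ m n, m ≤ n → h n ≤ b n m := fun m n hmn =>
    Finset.inf'_le _ (Finset.mem_range.2 (Nat.lt_succ_iff.2 hmn))
  obtain ⟨hupper, hsum⟩ := hL J φ h hJ0 hφ0 hφ1 hh0 hle
  set E : ℕ → Set N := fun n =>
    {x | topEnergy μ f p n ^ (1 / p) < singularPart μ β H g f n x} with hE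
  have hEm : ∀ n, MeasurableSet (E n) := fun n =>
    measurableSet_lt measurable_const (measurable_singularPart hg hf n)
  have hEν : ∀ n, ν (E n) ≤ ENNReal.ofReal (D * Real.exp (-σ * n)) := fun n =>
    measure_lt_singularPart_le hp0 hg hf hfp' (hD M N μ ν C₀ κ g f hκ hg hf hx hy n)
  have hnull : ν (⋂ n, E n) = 0 := by
    have hlim : Filter.Tendsto (fun n : ℕ => ENNReal.ofReal (D * Real.exp (-σ * n)))
        Filter.atTop (nhds 0) := by
      have h1 : Filter.Tendsto (fun n : ℕ => D * Real.exp (-σ * n)) Filter.atTop (nhds (D * 0)) := by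
        refine Filter.Tendsto.const_mul D (Real.tendsto_exp_atBot.comp ?_)
        exact tendsto_natCast_atTop_atTop.const_mul_atTop_of_neg (by linarith)
      rw [mul_zero] at h1
      simpa using ENNReal.tendsto_ofReal h1
    exact le_antisymm (ge_of_tendsto' hlim fun n => (measure_mono (iInter_subset E n)).trans (hEν n))
      zero_le
  have hF : ∀ᵐ x ∂ν, ∀ n, x ∉ E n → ∫⁻ y, g x y * f y ∂μ ≤ ENNReal.ofReal (h n) := by
    filter_upwards [hx] with x hx n hn
    obtain ⟨m, hm, hmeq⟩ := hmem n
    rw [hmeq]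
    exact lintegral_mul_le_pointwise hp hκ hH hC₀ hg.of_uncurry_left hx hf hfp hm hJ
      (not_lt.1 hn)
  refine ⟨?_, fun S => ?_⟩
  · filter_upwards [hF, measure_eq_zero_iff_ae_notMem.1 hnull] with x hx hx'
    obtain ⟨n, hn⟩ : ∃ n, x ∉ E n := by simpa using hx'
    exact ne_top_of_le_ne_top ENNReal.ofReal_ne_top (hx n hn)
  · refine (setLIntegral_exp_rpow_le hσ.le hβ.le hEm hh0 hF hnull S).trans ?_
    have hzero : ENNReal.ofReal (Real.exp (σ * h 0 ^ β)) ≤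
        ENNReal.ofReal (Real.exp (σ * L) * Real.exp (σ * J)) := by
      rw [← Real.exp_add]
      refine ENNReal.ofReal_le_ofReal (Real.exp_le_exp.2 ?_)
      have := hupper 0
      rw [Nat.cast_zero, zero_add] at this
      nlinarith
    have htail : ∑' n, ENNReal.ofReal (Real.exp (σ * h (n + 1) ^ β)) * ν (E n) ≤
        ENNReal.ofReal (D * Real.exp σ * L * Real.exp (σ * J)) := by
      calc _ ≤ ∑' n : ℕ, ENNReal.ofReal (D * Real.exp σ) *
            -- The set E n is paired with h (n + 1); this shift of index costs the factor e^σ.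
            ENNReal.ofReal (Real.exp (σ * (h (n + 1) ^ β - ((n + 1 : ℕ) : ℝ)))) := by
            refine ENNReal.tsum_le_tsum fun n => ?_
            refine (mul_le_mul_right (hEν n) _).trans (le_of_eq ?_)
            rw [← ENNReal.ofReal_mul (Real.exp_pos _).le, ← ENNReal.ofReal_mul (by positivity)]
            congr 1
            rw [mul_left_comm, mul_assoc D, ← Real.exp_add, ← Real.exp_add]
            congr 2
            push_cast
            ring
        _ = ENNReal.ofReal (D * Real.exp σ) * ∑' n : ℕ,
            ENNReal.ofReal (Real.exp (σ * (h (n + 1) ^ β - ((n + 1 : ℕ) : ℝ)))) :=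
            ENNReal.tsum_mul_left
        _ ≤ ENNReal.ofReal (D * Real.exp σ) * ENNReal.ofReal (L * Real.exp (σ * J)) := by
            refine mul_le_mul_right (le_trans ?_ hsum) _
            exact ENNReal.tsum_comp_le_tsum_of_injective (add_left_injective 1)
              (fun n : ℕ => ENNReal.ofReal (Real.exp (σ * (h n ^ β - n))))
        _ = _ := by
            rw [← ENNReal.ofReal_mul (by positivity)]
            congr 1
            ring
    set Q := ENNReal.ofReal ((Real.exp (σ * L) + D * Real.exp σ * L) * Real.exp (σ * J)) with hQ
    have hQ1 : ENNReal.ofReal (Real.exp (σ * L) * Real.exp (σ * J)) ≤ Q := by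
      refine ENNReal.ofReal_le_ofReal (mul_le_mul_of_nonneg_right ?_ (Real.exp_pos _).le)
      have : 0 ≤ D * Real.exp σ * L := by positivity
      linarith
    have hQ2 : ENNReal.ofReal (D * Real.exp σ * L * Real.exp (σ * J)) ≤ Q := by
      refine ENNReal.ofReal_le_ofReal (mul_le_mul_of_nonneg_right ?_ (Real.exp_pos _).le)
      linarith [Real.exp_pos (σ * L)]
    calc _ ≤ Q * ν S + Q := add_le_add (mul_le_mul_left (hzero.trans hQ1) _) (htail.trans hQ2)
      _ = Q * (1 + ν S) := by ring

/-! ### Extended real kernels and the regularized exponential. -/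

theorem EReal.abs_eq_max_toENNReal (x : EReal) : x.abs = max x.toENNReal (-x).toENNReal := by
  induction x with
  | bot => simp
  | top => simp
  | coe r =>
    rw [EReal.abs_def, ← EReal.coe_neg, EReal.toENNReal_of_ne_top (EReal.coe_ne_top _),
      EReal.toENNReal_of_ne_top (EReal.coe_ne_top _), EReal.toReal_coe, EReal.toReal_coe, abs,
      ← ENNReal.ofReal_max]

theorem EReal.measurable_abs' : Measurable EReal.abs := by
  have : EReal.abs = fun x => max x.toENNReal (-x).toENNReal :=
    funext EReal.abs_eq_max_toENNReal
  rw [this]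
  exact measurable_ereal_toENNReal.max (measurable_ereal_toENNReal.comp measurable_neg)

theorem EReal.enorm_toReal_le_abs (x : EReal) : ‖x.toReal‖ₑ ≤ x.abs := by
  induction x with
  | bot => simp
  | top => simp
  | coe r => rw [EReal.abs_def, EReal.toReal_coe, Real.enorm_eq_ofReal_abs]

theorem regExp_le_exp {m : ℕ} {t : ℝ} (ht : 0 ≤ t) : regExp m t ≤ Real.exp t :=
  sub_le_self _ (Finset.sum_nonneg fun j _ => by positivity)

theorem regExp_le_pow_mul_exp {m : ℕ} {t : ℝ} (ht : 0 ≤ t) :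
    regExp m t ≤ 2 * t ^ (m + 1) * Real.exp t := by
  have he : 1 ≤ Real.exp t := Real.one_le_exp ht
  rcases le_total t 1 with h | h
  · have h1 := Real.exp_bound' ht h (Nat.succ_pos m)
    have h2 : t ^ (m + 1) * (((m + 1 : ℕ) : ℝ) + 1) / (((m + 1).factorial : ℝ) * ((m + 1 : ℕ) : ℝ)) ≤
        2 * t ^ (m + 1) := by
      rw [div_le_iff₀ (by positivity)]
      have hf : (1 : ℝ) ≤ ((m + 1).factorial : ℝ) := by exact_mod_cast Nat.factorial_pos _
      have hm : (1 : ℝ) ≤ ((m + 1 : ℕ) : ℝ) := by exact_mod_cast Nat.succ_pos m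
      have hp : 0 ≤ t ^ (m + 1) := by positivity
      have : ((m + 1 : ℕ) : ℝ) + 1 ≤ 2 * (((m + 1).factorial : ℝ) * ((m + 1 : ℕ) : ℝ)) := by nlinarith
      nlinarith
    have h3 : 2 * t ^ (m + 1) ≤ 2 * t ^ (m + 1) * Real.exp t :=
      le_mul_of_one_le_right (by positivity) he
    rw [Nat.succ_eq_add_one] at h1
    unfold regExp
    linarith
  · refine (regExp_le_exp ht).trans ?_
    have : 1 ≤ t ^ (m + 1) := one_le_pow₀ h
    nlinarith [Real.exp_pos t]

/-- The first surviving Taylor term has order m + 1 ≥ p - 1, and β(p - 1) = p. As p > 1, the number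
p - 2 exceeds -1, so the natural ceiling agrees with the integer one. -/
theorem regExp_le_rpow {β p c u : ℝ} (hp : β.HolderConjugate p) (hc : 0 ≤ c) (hu : 0 ≤ u)
    (hu1 : u ≤ 1) :
    regExp ⌈p - 2⌉₊ (c * u ^ β) ≤ 2 * c ^ (⌈p - 2⌉₊ + 1) * Real.exp c * u ^ p := by
  set m := ⌈p - 2⌉₊ with hm
  have hβ := hp.pos
  have hub : u ^ β ≤ 1 := Real.rpow_le_one hu hu1 hβ.le
  have hub0 : 0 ≤ u ^ β := by positivity
  have hexp : p ≤ β * ((m + 1 : ℕ) : ℝ) := by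
    have h1 : p - 2 ≤ m := Nat.le_ceil _
    have h2 : (p - 1) * β = p := hp.symm.sub_one_mul_conj
    push_cast
    nlinarith
  refine (regExp_le_pow_mul_exp (by positivity)).trans ?_
  have h3 : (c * u ^ β) ^ (m + 1) ≤ c ^ (m + 1) * u ^ p := by
    rw [mul_pow]
    refine mul_le_mul_of_nonneg_left ?_ (by positivity)
    rw [← Real.rpow_natCast, ← Real.rpow_mul hu]
    exact Real.rpow_le_rpow_of_exponent_ge_of_imp hu hu1 hexp
      (fun _ h0 => absurd h0 (mul_pos hβ (by positivity)).ne')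
  have h4 : Real.exp (c * u ^ β) ≤ Real.exp c := Real.exp_le_exp.2 (mul_le_of_le_one_right hc hub)
  calc 2 * (c * u ^ β) ^ (m + 1) * Real.exp (c * u ^ β)
      ≤ 2 * (c ^ (m + 1) * u ^ p) * Real.exp c := by gcongr
    _ = _ := by ring

theorem measure_rearrangement_lt_le {X : Type*} [MeasurableSpace X] (μ : Measure X)
    (k : X → EReal) (t : ℝ) : μ {x | rearrangement μ k t < (k x).abs} ≤ ENNReal.ofReal t :=
  measure_upperLevel_lt_le μ (fun x => (k x).abs) (ENNReal.ofReal t)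

theorem kernelRearr₁_antitone {M N : Type*} [MeasurableSpace M] (μ : Measure M)
    (k : N → M → EReal) : Antitone (kernelRearr₁ μ k) := fun _ _ hst =>
  iSup_mono fun x => upperLevel_antitone μ (fun y => (k x y).abs) (ENNReal.ofReal_le_ofReal hst)

/-- If `k' =ᵐ k`, the distribution of `c |k'|` is controlled by any `s` exceeding `c` times the
rearrangement of `k`. -/
theorem measure_lt_abs_mul_le {X : Type*} [MeasurableSpace X] {μ : Measure X} {k k' : X → EReal}
    (hk : k =ᵐ[μ] k') {c s : ℝ≥0∞} {t : ℝ} (hs : rearrangement μ k t * c ≤ s) :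
    μ {x | s < (k' x).abs * c} ≤ ENNReal.ofReal t := by
  refine le_trans (measure_mono_ae ?_) (measure_rearrangement_lt_le μ k t)
  filter_upwards [hk] with x hx hlt
  have hlt' : s < (k' x).abs * c := hlt
  rw [← hx] at hlt'
  exact lt_of_mul_lt_mul_right' (hs.trans_lt hlt')

/-- Rescaling extends almost everywhere finiteness from the unit ball to all of L^p; the added 1
covers f = 0. -/
theorem exists_pos_mul_lintegral_rpow_le_one {X : Type*} [MeasurableSpace X] {μ : Measure X}
    {p : ℝ} (hp : 0 < p) {f : X → ℝ≥0∞} (hf : ∫⁻ x, f x ^ p ∂μ ≠ ⊤) :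
    ∃ a : ℝ≥0∞, a ≠ 0 ∧ a ≠ ⊤ ∧ ∫⁻ x, (a * f x) ^ p ∂μ ≤ 1 := by
  set I := ∫⁻ x, f x ^ p ∂μ with hI
  have hI1 : I + 1 ≠ ⊤ := ENNReal.add_ne_top.2 ⟨hf, ENNReal.one_ne_top⟩
  have h0 : (I + 1)⁻¹ ≠ 0 := ENNReal.inv_ne_zero.2 hI1
  have htop : (I + 1)⁻¹ ≠ ⊤ := ENNReal.inv_ne_top.2 (by simp)
  refine ⟨((I + 1)⁻¹) ^ (1 / p), ?_, ENNReal.rpow_ne_top_of_nonneg (by positivity) htop, ?_⟩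
  · exact (ENNReal.rpow_pos (pos_iff_ne_zero.2 h0) htop).ne'
  · simp_rw [ENNReal.mul_rpow_of_nonneg _ _ hp.le]
    rw [← ENNReal.rpow_mul, one_div_mul_cancel hp.ne', ENNReal.rpow_one,
      lintegral_const_mul' _ _ htop, ← hI]
    calc (I + 1)⁻¹ * I ≤ (I + 1)⁻¹ * (I + 1) := by gcongr; exact le_self_add
      _ ≤ 1 := ENNReal.inv_mul_le_one _

section Kernel

variable {M : Type u} {N : Type v} [MeasurableSpace M] {μ : Measure M} {k : N → M → EReal} {f : M → ℝ}

theorem aestronglyMeasurable_kernelIntegrand [MeasurableSpace N] {ν : Measure N} [SFinite μ]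
    [SFinite ν]
    (hk : AEMeasurable (Function.uncurry k) (ν.prod μ)) (hf : AEStronglyMeasurable f μ) :
    AEStronglyMeasurable (fun z : N × M => kernelIntegrand k f z.1 z.2) (ν.prod μ) :=
  (hk.ereal_toReal.aestronglyMeasurable).mul
    (hf.comp_quasiMeasurePreserving Measure.quasiMeasurePreserving_snd)

theorem lintegral_enorm_kernelIntegrand_mul_le {k' : N → M → EReal} {F : M → ℝ≥0∞} {x : N}
    (hk : k x =ᵐ[μ] k' x) (hF : (fun y => ‖f y‖ₑ) =ᵐ[μ] F) {c : ℝ≥0∞} (hc : c ≠ ⊤) :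
    (∫⁻ y, ‖kernelIntegrand k f x y‖ₑ ∂μ) * c ≤ ∫⁻ y, (k' x y).abs * c * F y ∂μ := by
  rw [← lintegral_mul_const' _ _ hc]
  refine lintegral_mono_ae ?_
  filter_upwards [hk, hF] with y hy hFy
  rw [kernelIntegrand, enorm_mul, hy, hFy, mul_right_comm]
  gcongr
  exact EReal.enorm_toReal_le_abs _

theorem abs_integralOp_mul_le {x : N} {c : ℝ} {I : ℝ≥0∞} (hI : I ≠ ⊤)
    (h : (∫⁻ y, ‖kernelIntegrand k f x y‖ₑ ∂μ) * ENNReal.ofReal c ≤ I) :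
    |integralOp μ k f x| * c ≤ I.toReal := by
  refine (ENNReal.ofReal_le_iff_le_toReal hI).1 ?_
  rw [ENNReal.ofReal_mul (abs_nonneg _), ← Real.enorm_eq_ofReal_abs]
  refine le_trans (mul_le_mul_left ?_ _) h
  exact enorm_integral_le_lintegral_enorm _

end Kernel

/-! ### Reduction to a measurable kernel with A = 1, and conclusion. -/

/-- Integrability of the kernel and the exponential estimate on arbitrary sets `S`. -/
theorem exists_adams_bound (β σ γ A B H : ℝ) (hβ : 1 < β) (hσ : 0 < σ) (hσ' : σ ≤ 1) (hγ : 1 < γ)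
    (hA : 0 < A) (hB : 0 ≤ B) (hH : 0 ≤ H) :
    ∃ C : ℝ, 0 < C ∧
      ∀ (M : Type u) (N : Type v) [MeasurableSpace M] [MeasurableSpace N]
        (μ : Measure M) (ν : Measure N) [SFinite μ] [SFinite ν] (k : N → M → EReal),
        AEMeasurable (Function.uncurry k) (ν.prod μ) →
        (∀ t : ℝ, 0 < t → t ≤ 1 → kernelRearr₁ μ k t ≤
          ENNReal.ofReal (A ^ (1 / β) * t ^ (-(1 / β)) * (1 + H * (1 + |Real.log t|) ^ (-γ)))) →
        (∀ t : ℝ, 0 < t → kernelRearr₂ ν k t ≤ ENNReal.ofReal (B * t ^ (-(1 / (σ * β))))) →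
        tailIntegral μ k A β < ⊤ →
        ∀ f : M → ℝ, MemLp f (ENNReal.ofReal β.conjExponent) μ →
          (∀ᵐ x ∂ν, Integrable (kernelIntegrand k f x) μ) ∧
          (eLpNorm f (ENNReal.ofReal β.conjExponent) μ ≤ 1 → ∀ S : Set N,
            ∫⁻ x in S, ENNReal.ofReal (Real.exp (σ / A * |integralOp μ k f x| ^ β)) ∂ν ≤
              ENNReal.ofReal (C * Real.exp (σ * (tailIntegral μ k A β).toReal)) *
                (1 + ν S)) := by
  have hp := Real.HolderConjugate.conjExponent hβ
  set p := β.conjExponent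
  have hβ0 := hp.pos
  have hp0 := hp.symm.pos
  set c := A ^ (-(1 / β)) with hc
  have hc0 : 0 < c := by positivity
  have hcβ : c ^ β = A⁻¹ := by
    rw [hc, ← Real.rpow_mul hA.le, show -(1 / β) * β = -1 by field_simp, Real.rpow_neg_one]
  have hcA : A ^ (1 / β) * c = 1 := by
    rw [hc, Real.rpow_neg hA.le, mul_inv_cancel₀ (by positivity)]
  -- B + 1 replaces B, which may be 0, because the singular-part estimate divides by its constant.
  obtain ⟨C, hC0, hC⟩ := exists_setLIntegral_exp_le.{u, v} (B := (B + 1) * c) hp hσ hσ' hγ hH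
    (by positivity)
  refine ⟨C, hC0, ?_⟩
  intro M N _ _ μ ν _ _ k hk hk1 hk2 hJ f hf
  set e := ENNReal.ofReal c with he
  have he0 : e ≠ 0 := (ENNReal.ofReal_pos.2 hc0).ne'
  have hetop : e ≠ ⊤ := ENNReal.ofReal_ne_top
  -- A measurable representative. By Fubini almost every section agrees almost everywhere with that
  -- of k, so the rearrangement bounds pass to almost every section, which is all that is needed.
  set k' : N → M → EReal := fun x y => hk.mk _ (x, y) with hk'
  have hk'm : Measurable (Function.uncurry k') := hk.measurable_mk
  have hkk : ∀ᵐ z ∂ν.prod μ, k z.1 z.2 = k' z.1 z.2 := hk.ae_eq_mk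
  have hx : ∀ᵐ x ∂ν, k x =ᵐ[μ] k' x := Measure.ae_ae_of_ae_prod hkk
  have hy : ∀ᵐ y ∂μ, (fun x => k x y) =ᵐ[ν] fun x => k' x y :=
    Measure.ae_ae_of_ae_prod
      ((Measure.measurePreserving_swap (μ := μ) (ν := ν)).quasiMeasurePreserving.ae hkk)
  set g : N → M → ℝ≥0∞ := fun x y => (k' x y).abs * e with hg
  have hgm : Measurable (Function.uncurry g) :=
    (EReal.measurable_abs'.comp hk'm).mul measurable_const
  set κ : ℝ → ℝ≥0∞ := fun t => kernelRearr₁ μ k t * e with hκ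
  have hanti : Antitone κ := fun s t hst => mul_le_mul_left (kernelRearr₁_antitone μ k hst) _
  have hκ1 : ∀ t : ℝ, 0 < t → t ≤ 1 →
      κ t ≤ ENNReal.ofReal (t ^ (-(1 / β)) * (1 + H * (1 + |Real.log t|) ^ (-γ))) := by
    intro t ht ht1
    refine (mul_le_mul_left (hk1 t ht ht1) e).trans (le_of_eq ?_)
    have h1 : 0 ≤ (1 + |Real.log t|) ^ (-γ) := by positivity
    rw [he, ← ENNReal.ofReal_mul (by positivity)]
    congr 1
    calc A ^ (1 / β) * t ^ (-(1 / β)) * (1 + H * (1 + |Real.log t|) ^ (-γ)) * c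
        = (A ^ (1 / β) * c) * (t ^ (-(1 / β)) * (1 + H * (1 + |Real.log t|) ^ (-γ))) := by ring
      _ = _ := by rw [hcA, one_mul]
  have hκJ : ∫⁻ t in Ioi 1, κ t ^ β = tailIntegral μ k A β := by
    have h1 : e ^ β = (ENNReal.ofReal A)⁻¹ := by
      rw [he, ENNReal.ofReal_rpow_of_pos hc0, hcβ, ENNReal.ofReal_inv_of_pos hA]
    have h2 : e ^ β ≠ ⊤ := ENNReal.rpow_ne_top_of_nonneg hβ0.le hetop
    simp only [hκ, ENNReal.mul_rpow_of_nonneg _ _ hβ0.le]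
    rw [lintegral_mul_const' _ _ h2, h1, mul_comm, tailIntegral]
  have hdx : ∀ᵐ x ∂ν, ∀ t : ℝ, 0 < t → μ {y | κ t < g x y} ≤ ENNReal.ofReal t := by
    filter_upwards [hx] with x hx t _
    refine measure_lt_abs_mul_le hx (mul_le_mul_left ?_ e)
    exact le_iSup (fun x => rearrangement μ (fun y => k x y) t) x
  have hdy : ∀ᵐ y ∂μ, ∀ t : ℝ, 0 < t →
      ν {x | ENNReal.ofReal ((B + 1) * c * t ^ (-(1 / (σ * β)))) < g x y} ≤
        ENNReal.ofReal t := by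
    filter_upwards [hy] with y hy t ht
    refine measure_lt_abs_mul_le hy ?_
    have h1 : rearrangement ν (fun x => k x y) t ≤ kernelRearr₂ ν k t :=
      le_iSup (fun y => rearrangement ν (fun x => k x y) t) y
    have h2 : 0 ≤ t ^ (-(1 / (σ * β))) := by positivity
    refine (mul_le_mul_left (h1.trans (hk2 t ht)) e).trans ?_
    rw [he, ← ENNReal.ofReal_mul (by positivity)]
    refine ENNReal.ofReal_le_ofReal ?_
    rw [mul_right_comm]
    gcongr
    linarith
  have hcore := hC M N μ ν κ g hanti hκ1 (hκJ ▸ hJ.ne) hgm hdx hdy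
  rw [hκJ] at hcore
  set F : M → ℝ≥0∞ := fun y => ‖hf.1.mk f y‖ₑ with hF
  have hFm : Measurable F := hf.1.stronglyMeasurable_mk.measurable.enorm
  have hFf : (fun y => ‖f y‖ₑ) =ᵐ[μ] F := by
    filter_upwards [hf.1.ae_eq_mk] with y hy
    rw [hF]
    simp only [← hy]
  have hp_ne0 : ENNReal.ofReal p ≠ 0 := (ENNReal.ofReal_pos.2 hp0).ne'
  have hnorm : eLpNorm f (ENNReal.ofReal p) μ = (∫⁻ y, F y ^ p ∂μ) ^ (1 / p) := by
    rw [eLpNorm_eq_lintegral_rpow_enorm_toReal hp_ne0 ENNReal.ofReal_ne_top,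
      ENNReal.toReal_ofReal hp0.le]
    congr 1
    refine lintegral_congr_ae ?_
    filter_upwards [hFf] with y hy
    rw [← hy]
  have hFtop : ∫⁻ y, F y ^ p ∂μ ≠ ⊤ := by
    have h1 := hf.2
    rw [hnorm] at h1
    intro htop
    rw [htop, ENNReal.top_rpow_of_pos (by positivity)] at h1
    exact lt_irrefl _ h1
  have hfin : ∀ᵐ x ∂ν, ∫⁻ y, g x y * F y ∂μ ≠ ⊤ := by
    obtain ⟨a, ha0, hatop, ha⟩ := exists_pos_mul_lintegral_rpow_le_one hp0 hFtop
    filter_upwards [(hcore (fun y => a * F y) (hFm.const_mul a) ha).1] with x hx htop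
    apply hx
    simp_rw [mul_left_comm _ a]
    rw [lintegral_const_mul' _ _ hatop, htop, ENNReal.mul_top ha0]
  have hdom : ∀ᵐ x ∂ν, (∫⁻ y, ‖kernelIntegrand k f x y‖ₑ ∂μ) * e ≤ ∫⁻ y, g x y * F y ∂μ := by
    filter_upwards [hx] with x hx
    exact lintegral_enorm_kernelIntegrand_mul_le hx hFf hetop
  refine ⟨?_, fun hf1 S => ?_⟩
  · filter_upwards [hfin, hdom, (aestronglyMeasurable_kernelIntegrand hk hf.1).prodMk_left]
      with x hx hdx hmx
    refine ⟨hmx, ?_⟩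
    rw [hasFiniteIntegral_iff_enorm, lt_top_iff_ne_top]
    intro htop
    rw [htop, ENNReal.top_mul he0] at hdx
    exact hx (top_le_iff.1 hdx)
  · have hF1 : ∫⁻ y, F y ^ p ∂μ ≤ 1 := by
      rw [hnorm] at hf1
      have := ENNReal.rpow_le_rpow hf1 hp0.le
      rwa [← ENNReal.rpow_mul, one_div_mul_cancel hp0.ne', ENNReal.rpow_one,
        ENNReal.one_rpow] at this
    refine le_trans (lintegral_mono_ae (ae_restrict_of_ae ?_)) ((hcore F hFm hF1).2 S)
    filter_upwards [hfin, hdom] with x hx hdx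
    have h1 := abs_integralOp_mul_le hx hdx
    refine ENNReal.ofReal_le_ofReal (Real.exp_le_exp.2 ?_)
    rw [div_mul_eq_mul_div, mul_div_assoc]
    refine mul_le_mul_of_nonneg_left ?_ hσ.le
    calc |integralOp μ k f x| ^ β / A = (|integralOp μ k f x| * c) ^ β := by
          rw [Real.mul_rpow (abs_nonneg _) hc0.le, hcβ, div_eq_mul_inv]
      _ ≤ _ := Real.rpow_le_rpow (by positivity) h1 hβ0.le

theorem theorem3 (β σ γ A B H : ℝ) (hβ : 1 < β) (hσ : 0 < σ) (hσ' : σ ≤ 1) (hγ : 1 < γ)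
    (hA : 0 < A) (hB : 0 ≤ B) (hH : 0 ≤ H) :
    ∃ C : ℝ, 0 < C ∧
      ∀ (M : Type u) (N : Type v) [MeasurableSpace M] [MeasurableSpace N]
        (μ : Measure M) (ν : Measure N) [SigmaFinite μ] [SigmaFinite ν] (k : N → M → EReal),
        AEMeasurable (Function.uncurry k) (ν.prod μ) →
        (∀ t : ℝ, 0 < t → t ≤ 1 → kernelRearr₁ μ k t ≤
          ENNReal.ofReal (A ^ (1 / β) * t ^ (-(1 / β)) * (1 + H * (1 + |Real.log t|) ^ (-γ)))) →
        (∀ t : ℝ, 0 < t → kernelRearr₂ ν k t ≤ ENNReal.ofReal (B * t ^ (-(1 / (σ * β))))) →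
        tailIntegral μ k A β < ⊤ →
        (∀ f : M → ℝ, MemLp f (ENNReal.ofReal β.conjExponent) μ →
          ∀ᵐ x ∂ν, Integrable (kernelIntegrand k f x) μ) ∧
        (ν univ < ⊤ →
          ∀ f : M → ℝ, MemLp f (ENNReal.ofReal β.conjExponent) μ →
            eLpNorm f (ENNReal.ofReal β.conjExponent) μ ≤ 1 →
            ∫⁻ x, ENNReal.ofReal (Real.exp (σ / A * |integralOp μ k f x| ^ β)) ∂ν ≤
              ENNReal.ofReal (C * Real.exp (σ * (tailIntegral μ k A β).toReal)) *
                (1 + tailIntegral μ k A β + ν univ)) ∧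
        (∀ f : M → ℝ, MemLp f (ENNReal.ofReal β.conjExponent) μ →
          eLpNorm f (ENNReal.ofReal β.conjExponent) μ ≤ 1 →
          ∫⁻ x, ENNReal.ofReal
              (regExp ⌈β.conjExponent - 2⌉₊ (σ / A * |integralOp μ k f x| ^ β)) ∂ν ≤
            ENNReal.ofReal (C * Real.exp (σ * (tailIntegral μ k A β).toReal)) *
              (1 + tailIntegral μ k A β +
                eLpNorm (integralOp μ k f) (ENNReal.ofReal β.conjExponent) ν
                  ^ β.conjExponent)) := by
  have hp := Real.HolderConjugate.conjExponent hβ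
  set p := β.conjExponent
  have hβ0 := hp.pos
  have hp0 := hp.symm.pos
  obtain ⟨C, hC0, hC⟩ := exists_adams_bound.{u, v} β σ γ A B H hβ hσ hσ' hγ hA hB hH
  set a := 2 * (σ / A) ^ (⌈p - 2⌉₊ + 1) * Real.exp (σ / A) with ha
  have ha0 : 0 < a := by positivity
  refine ⟨C + a, by positivity, ?_⟩
  intro M N _ _ μ ν _ _ k hk hk1 hk2 hJ
  have hmain := hC M N μ ν k hk hk1 hk2 hJ
  set J := tailIntegral μ k A β
  set X := Real.exp (σ * J.toReal) with hX
  have hX1 : 1 ≤ X := Real.one_le_exp (mul_nonneg hσ.le ENNReal.toReal_nonneg)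
  have hCa : ENNReal.ofReal (C * X) ≤ ENNReal.ofReal ((C + a) * X) := by
    refine ENNReal.ofReal_le_ofReal (mul_le_mul_of_nonneg_right (by linarith) (by linarith))
  refine ⟨fun f hf => (hmain f hf).1, fun _ f hf hf1 => ?_, fun f hf hf1 => ?_⟩
  · have h := (hmain f hf).2 hf1 univ
    rw [Measure.restrict_univ] at h
    -- The estimate on sets holds without the summand J.
    refine h.trans (mul_le_mul' hCa (add_le_add le_self_add le_rfl))
  -- The full exponential is used only where |Tf| ≥ 1, a set of measure at most ‖Tf‖_p^p by
  -- Chebyshev.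
  · set S : Set N := {x | (1 : ℝ≥0∞) ≤ ‖integralOp μ k f x‖ₑ ^ p} with hS
    have hTm : AEStronglyMeasurable (integralOp μ k f) ν :=
      (aestronglyMeasurable_kernelIntegrand hk hf.1).integral_prod_right'
    have hTp : AEMeasurable (fun x => ‖integralOp μ k f x‖ₑ ^ p) ν := hTm.enorm.pow_const p
    set V := ∫⁻ x, ‖integralOp μ k f x‖ₑ ^ p ∂ν with hV
    have hnorm : eLpNorm (integralOp μ k f) (ENNReal.ofReal p) ν ^ p = V := by
      rw [eLpNorm_eq_lintegral_rpow_enorm_toReal (ENNReal.ofReal_pos.2 hp0).ne'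
        ENNReal.ofReal_ne_top, ENNReal.toReal_ofReal hp0.le, ← ENNReal.rpow_mul,
        one_div_mul_cancel hp0.ne', ENNReal.rpow_one]
    have hSV : ν S ≤ V := by
      simpa using mul_meas_ge_le_lintegral₀ hTp 1
    have hpt : ∀ x, ENNReal.ofReal (regExp ⌈p - 2⌉₊ (σ / A * |integralOp μ k f x| ^ β)) ≤
        S.indicator (fun x => ENNReal.ofReal (Real.exp (σ / A * |integralOp μ k f x| ^ β))) x +
          ENNReal.ofReal a * ‖integralOp μ k f x‖ₑ ^ p := by
      intro x
      by_cases hx : x ∈ S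
      · rw [indicator_of_mem hx]
        refine le_add_right (ENNReal.ofReal_le_ofReal (regExp_le_exp (by positivity)))
      · refine le_add_left ?_
        have hlt : |integralOp μ k f x| < 1 := by
          by_contra! hge
          refine hx ?_
          show (1 : ℝ≥0∞) ≤ ‖integralOp μ k f x‖ₑ ^ p
          rw [Real.enorm_eq_ofReal_abs]
          exact ENNReal.one_le_rpow (by simpa using ENNReal.ofReal_le_ofReal hge) hp0
        rw [Real.enorm_eq_ofReal_abs, ENNReal.ofReal_rpow_of_nonneg (abs_nonneg _) hp0.le,
          ← ENNReal.ofReal_mul ha0.le]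
        exact ENNReal.ofReal_le_ofReal
          (regExp_le_rpow hp (by positivity) (abs_nonneg _) hlt.le)
    rw [hnorm]
    calc _ ≤ ∫⁻ x, (S.indicator
          (fun x => ENNReal.ofReal (Real.exp (σ / A * |integralOp μ k f x| ^ β))) x +
          ENNReal.ofReal a * ‖integralOp μ k f x‖ₑ ^ p) ∂ν := lintegral_mono hpt
      _ = ∫⁻ x, S.indicator
          (fun x => ENNReal.ofReal (Real.exp (σ / A * |integralOp μ k f x| ^ β))) x ∂ν +
          ENNReal.ofReal a * V := by
          rw [lintegral_add_right' _ (hTp.const_mul _), lintegral_const_mul' _ _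
            ENNReal.ofReal_ne_top]
      _ ≤ ENNReal.ofReal (C * X) * (1 + V) + ENNReal.ofReal (a * X) * (1 + V) := by
          refine add_le_add ?_ (mul_le_mul' ?_ le_add_self)
          · refine (lintegral_indicator_le _ _).trans (((hmain f hf).2 hf1 S).trans ?_)
            gcongr
          · exact ENNReal.ofReal_le_ofReal (le_mul_of_one_le_right ha0.le hX1)
      _ = ENNReal.ofReal ((C + a) * X) * (1 + V) := by
          rw [← add_mul, ← ENNReal.ofReal_add (by positivity) (by positivity), ← add_mul]
      _ ≤ _ := by
          gcongr
          exact le_self_add
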